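/- Let $m\neq 0$ and $e$ be real numbers and let $\eta=\mathrm{diag}(1,-1,-1,-1)$. Consider on Minkowski space $\mathbb R^{4}$ a complex vector field $W^+_\mu$, with $W^-_\mu=\overline{W^+_\mu}$, and a real potential $A_\mu$ ($\mu=0,1,2,3$), with the action $$S=\int d^4x\Big[-\tfrac12\eta^{\mu\rho}\eta^{\nu\sigma}W^-_{\mu\nu}W^+_{\rho\sigma}+m^2\eta^{\mu\nu}W^-_\mu W^+_\nu-\tfrac14F^{\mu\nu}F_{\mu\nu}\Big],$$ where $F_{\mu\nu}=\partial_\mu A_\nu-\partial_\nu A_\mu$, $D_\mu W^\pm_\nu=\partial_\mu W^\pm_\nu\mp ieA_\mu W^\pm_\nu$ and $W^\pm_{\mu\nu}=D_\mu W^\pm_\nu-D_\nu W^\pm_\mu$. Suppose that $W^\pm_\mu$, $A_\mu$ are $C^\infty$ on $\mathbb R^4$, satisfy the equations of motion (the Euler--Lagrange equations of $S$), and tend to $0$ as $|\vec x|\to\infty$ for every $t$. Suppose that they are periodic in time up to a spatial rotation and a coordinate shift: there are $\tilde T\in(0,\infty)$, $\Omega\in SO(3)$ and $\vec l\in\mathbb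 R^3$ with $\Omega\vec l=\vec l$ and $|\vec l|/\tilde T<1$ such that $$\Psi(t+\tilde T,\vec x)=\Lambda(\Omega)\,\Psi(t,\Omega^{-1}\vec x-\vec l)\qquad\text{for all }t,\vec x,$$ for $\Psi=W^\pm$ and $\Psi=A$, where $\Lambda(\Omega)$ leaves the component $\Psi_0$ unchanged and rotates $(\Psi_1,\Psi_2,\Psi_3)$ by $\Omega$. Pass by the Lorentz boost with velocity $\vec l/\tilde T$ to the inertial frame in which the shift is zero; the period there is $T=\tilde T\sqrt{1-|\vec l|^2/\tilde T^2}$. Suppose that, for the fields in that frame (sums over $i,j=1,2,3$), the integrals $$\int_0^T\!dt\int d^3x\,W^-_{0i}W^+_{0i},\quad \int_0^T\!dt\int d^3x\,\tfrac12W^-_{ij}W^+_{ij},\quad m^2\!\int_0^T\!dt\int d^3x\,W^-_0W^+_0,$$ $$m^2\!\int_0^T\!dt\int d^3x\,W^-_iW^+_i,\quad \int_0^T\!dt\int d^3x\,\tfrac12F_{0i}F_{0i},\quad \int_0^T\!dt\int d^3x\,\tfrac14F_{ij}F_{ij}$$ are finite. Then the solution is trivial: $W^\pm_\mu\equiv0$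 and $F_{\mu\nu}\equiv0$, and $A_\mu$ is a pure gauge, $A_\mu=\partial_\mu\chi$ for a smooth function $\chi:\mathbb R^4\to\mathbb R$. In other words, there are no non-trivial non-topological solitons of this kind. -/

import Mathlib

open scoped ContDiff Topology

namespace ChargedVector

noncomputable section

/-- Minkowski space-time with inertial coordinates `x 0 = t` and `x 1, x 2, x 3` (units `c = 1`). -/
abbrev Spacetime := Fin 4 → ℝ

/-- The event with time `t` and spatial position `x`. -/
def event (t : ℝ) (x : Fin 3 → ℝ) : Spacetime := Matrix.vecCons t x

/-- The values `(W⁺_μ, A_μ)` of the complex vector field and of the real electromagnetic potential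
(components with lower indices). The field `W⁻_μ` is the complex conjugate of `W⁺_μ`. -/
abbrev FieldValue := (Fin 4 → ℂ) × (Fin 4 → ℝ)

/-- The partial derivative `∂_μ` of a function on space-time. -/
def partialDeriv {V : Type*} [NormedAddCommGroup V] [NormedSpace ℝ V]
    (μ : Fin 4) (f : Spacetime → V) (x : Spacetime) : V :=
  fderiv ℝ f x (Pi.single μ 1)

/-- The collection of all first derivatives, `grad Ψ x μ = ∂_μ Ψ (x)`. -/
def grad {V : Type*} [NormedAddCommGroup V] [NormedSpace ℝ V]
    (Ψ : Spacetime → V) (x : Spacetime) : Fin 4 → V :=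
  fun μ => partialDeriv μ Ψ x

/-- The Euler-Lagrange equations of the action `∫ d⁴x L(Ψ, ∂Ψ)`, for a Lagrangian density `L` that
depends on the field value and on its first derivatives:
`∑_μ ∂_μ (∂L/∂(∂_μ Ψ) · v) = ∂L/∂Ψ · v` at every point and for every direction `v`. -/
def EulerLagrange {V : Type*} [NormedAddCommGroup V] [NormedSpace ℝ V]
    (L : V → (Fin 4 → V) → ℝ) (Ψ : Spacetime → V) : Prop :=
  ∀ (x : Spacetime) (v : V),
    ∑ μ, partialDeriv μ
        (fun y => lineDeriv ℝ (fun p => L (Ψ y) p) (grad Ψ y) (Pi.single μ v)) x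
      = lineDeriv ℝ (fun u => L u (grad Ψ x)) (Ψ x) v

/-- The diagonal of the Minkowski metric `η = diag(1, -1, -1, -1)`. -/
def eta : Fin 4 → ℝ := ![1, -1, -1, -1]

/-- `D_μ W⁺_ν = ∂_μ W⁺_ν - i e A_μ W⁺_ν`, where `u` is the value of the fields and `p μ` is the
value of their derivatives `∂_μ`. -/
def covDeriv (e : ℝ) (u : FieldValue) (p : Fin 4 → FieldValue) (μ ν : Fin 4) : ℂ :=
  (p μ).1 ν - Complex.I * e * u.2 μ * u.1 ν

/-- `W⁺_{μν} = D_μ W⁺_ν - D_ν W⁺_μ`; the complex conjugate of this is `W⁻_{μν}`. -/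
def strengthW (e : ℝ) (u : FieldValue) (p : Fin 4 → FieldValue) (μ ν : Fin 4) : ℂ :=
  covDeriv e u p μ ν - covDeriv e u p ν μ

/-- `F_{μν} = ∂_μ A_ν - ∂_ν A_μ`. -/
def strengthF (p : Fin 4 → FieldValue) (μ ν : Fin 4) : ℝ :=
  (p μ).2 ν - (p ν).2 μ

/-- The Lagrangian density
`-(1/2) W⁻^{μν} W⁺_{μν} + m² W⁻^μ W⁺_μ - (1/4) F^{μν} F_{μν}`;
indices are raised with `η`, and `W⁻_{μν} W⁺_{μν} = |W⁺_{μν}|²` (no sum),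
`W⁻_μ W⁺_μ = |W⁺_μ|²` (no sum). -/
def lagrangian (e m : ℝ) (u : FieldValue) (p : Fin 4 → FieldValue) : ℝ :=
  -(1 / 2) * ∑ μ, ∑ ν, eta μ * eta ν * ‖strengthW e u p μ ν‖ ^ 2
    + m ^ 2 * ∑ μ, eta μ * ‖u.1 μ‖ ^ 2
    - (1 / 4) * ∑ μ, ∑ ν, eta μ * eta ν * strengthF p μ ν ^ 2

/-- The integrands of `Π_{W0}, Π_{W1}, V₀, V₁, Π_{A0}, Π_{A1}`, in this order. The spatial index
`i = 1, 2, 3` is `Fin.succ i` with `i : Fin 3`. -/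
def density (e m : ℝ) (u : FieldValue) (p : Fin 4 → FieldValue) : Fin 6 → ℝ :=
  ![∑ i : Fin 3, ‖strengthW e u p 0 i.succ‖ ^ 2,
    ∑ i : Fin 3, ∑ j : Fin 3, (1 / 2) * ‖strengthW e u p i.succ j.succ‖ ^ 2,
    m ^ 2 * ‖u.1 0‖ ^ 2,
    m ^ 2 * ∑ i : Fin 3, ‖u.1 i.succ‖ ^ 2,
    ∑ i : Fin 3, (1 / 2) * strengthF p 0 i.succ ^ 2,
    ∑ i : Fin 3, ∑ j : Fin 3, (1 / 4) * strengthF p i.succ j.succ ^ 2]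

/-- All six integrals over `0 ≤ t ≤ T`, `x ∈ ℝ³` are finite. -/
def FiniteIntegrals (e m T : ℝ) (Ψ : Spacetime → FieldValue) : Prop :=
  ∀ k : Fin 6, MeasureTheory.IntegrableOn (fun x => density e m (Ψ x) (grad Ψ x) k)
    {x : Spacetime | 0 ≤ x 0 ∧ x 0 ≤ T}

/-- All the fields tend to zero at spatial infinity, at every time. -/
def VanishesAtSpatialInfinity (Ψ : Spacetime → FieldValue) : Prop :=
  ∀ t : ℝ, Filter.Tendsto (fun x : Fin 3 → ℝ => Ψ (event t x))
    (Filter.cocompact (Fin 3 → ℝ)) (𝓝 0)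

/-- The representation of the rotation group carried by a four-vector: the time component is a
scalar, the spatial components are a vector. -/
def rotate {K : Type*} [Semiring K] [Algebra ℝ K] (Ω : Matrix.specialOrthogonalGroup (Fin 3) ℝ)
    (a : Fin 4 → K) : Fin 4 → K :=
  Matrix.vecCons (a 0) (fun i : Fin 3 => ∑ j : Fin 3, Ω.1 i j • a j.succ)

/-- Periodicity in time with period `T`, up to the rotation `Ω` and the shift `l`:
`Ψ(t + T, x) = Λ(Ω) Ψ(t, Ω⁻¹ x - l)`. -/
def PeriodicUpTo (T : ℝ) (Ω : Matrix.specialOrthogonalGroup (Fin 3) ℝ) (l : Fin 3 → ℝ)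
    (Ψ : Spacetime → FieldValue) : Prop :=
  ∀ (t : ℝ) (x : Fin 3 → ℝ),
    (Ψ (event (t + T) x)).1 = rotate Ω (Ψ (event t ((Ω⁻¹).1.mulVec x - l))).1 ∧
    (Ψ (event (t + T) x)).2 = rotate Ω (Ψ (event t ((Ω⁻¹).1.mulVec x - l))).2

/-- The Lorentz factor of the velocity `v`. -/
def lorentzFactor (v : Fin 3 → ℝ) : ℝ := 1 / √(1 - v ⬝ᵥ v)

/-- The Lorentz boost that takes the coordinates `(t', x')` of the inertial frame moving with
velocity `v` to the original coordinates:
`t = γ (t' + v · x')`, `x = x' + (γ² / (1 + γ)) (v · x') v + γ t' v`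
(and `γ² / (1 + γ) = (γ - 1) / |v|²` when `v ≠ 0`). -/
def boost (v : Fin 3 → ℝ) : Matrix (Fin 4) (Fin 4) ℝ :=
  let γ := lorentzFactor v
  Matrix.of (Matrix.vecCons (Matrix.vecCons γ (fun j => γ * v j))
    (fun i : Fin 3 => Matrix.vecCons (γ * v i)
      (fun j : Fin 3 => (if i = j then 1 else 0) + γ ^ 2 / (1 + γ) * v i * v j)))

/-- The fields in the primed coordinates, when the original coordinates are `x = M x'`; the fields
are covectors: `W'_μ(x') = ∑_ν (∂x^ν/∂x'^μ) W_ν(M x')`, and likewise for `A`. -/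
def changeFrame (M : Matrix (Fin 4) (Fin 4) ℝ) (Ψ : Spacetime → FieldValue) :
    Spacetime → FieldValue :=
  fun y => (fun μ => ∑ ν, M ν μ • (Ψ (M.mulVec y)).1 ν, fun μ => ∑ ν, M ν μ * (Ψ (M.mulVec y)).2 ν)

end

end ChargedVector

/-!
Two currents are combined. By the Proca equation the virial current `W_{μρ} W^ρ` has divergence
`½ W_{ij} W_{ij} - W_{0i} W_{0i} - m² (W_0 W_0 - W_i W_i)`. As the stress tensor `T` is conserved,
the divergence of the dilation current `x^k T_{μk}` is `-T_{kk}`. In the difference of the two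
currents the terms of indefinite sign cancel, which leaves the non-negative density
`2 m² W_0 W_0 + W_{ij} W_{ij} + ½ F_{0i} F_{0i} + ¼ F_{ij} F_{ij}`.

In the frame where the shift is zero, the integral of this density over one period and all of space
vanishes: the current is covariant under rotations, so the boundary terms at the two ends of the
period cancel, and cutting the current off with `χ(r x)` costs an error that tends to zero with `r`
by dominated convergence, since `|r x| |∇χ(r x)|` is bounded. Hence `W_0`, `W_{ij}` and `F` vanish.

No force then acts on the stress tensor of the mass term, so that its own dilation current has
divergence `½ W_i W_i`, and the same argument gives `W_i = 0`. By the Poincaré lemma, `F = 0` makes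
the potential a gradient.
-/

namespace ChargedVector

noncomputable section

open scoped RealInnerProductSpace

section PartialDeriv

variable {V : Type*} [NormedAddCommGroup V] [NormedSpace ℝ V] {f g : Spacetime → V}
  {x : Spacetime}

theorem differentiableAt_of_smooth (hf : ContDiff ℝ ∞ f) : DifferentiableAt ℝ f x :=
  hf.differentiable (by simp) x

theorem contDiff_partialDeriv (hf : ContDiff ℝ ∞ f) (μ : Fin 4) :
    ContDiff ℝ ∞ (partialDeriv μ f) :=
  (hf.fderiv_right (m := ∞) le_rfl).clm_apply contDiff_const

theorem partialDeriv_add (hf : DifferentiableAt ℝ f x) (hg : DifferentiableAt ℝ g x) (μ : Fin 4) :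
    partialDeriv μ (fun y => f y + g y) x = partialDeriv μ f x + partialDeriv μ g x := by
  simp only [partialDeriv, fderiv_fun_add hf hg, add_apply]

theorem partialDeriv_sub (hf : DifferentiableAt ℝ f x) (hg : DifferentiableAt ℝ g x) (μ : Fin 4) :
    partialDeriv μ (fun y => f y - g y) x = partialDeriv μ f x - partialDeriv μ g x := by
  simp only [partialDeriv, fderiv_fun_sub hf hg, sub_apply]

theorem partialDeriv_sum {ι : Type*} (s : Finset ι) {F : ι → Spacetime → V}
    (hF : ∀ i ∈ s, DifferentiableAt ℝ (F i) x) (μ : Fin 4) :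
    partialDeriv μ (fun y => ∑ i ∈ s, F i y) x = ∑ i ∈ s, partialDeriv μ (F i) x := by
  simp only [partialDeriv, fderiv_fun_sum hF, sum_apply]

theorem partialDeriv_smul {a : Spacetime → ℝ} (ha : DifferentiableAt ℝ a x)
    (hf : DifferentiableAt ℝ f x) (μ : Fin 4) :
    partialDeriv μ (fun y => a y • f y) x
      = a x • partialDeriv μ f x + partialDeriv μ a x • f x := by
  simp [partialDeriv, fderiv_fun_smul ha hf]

theorem partialDeriv_const_smul (c : ℝ) (hf : DifferentiableAt ℝ f x) (μ : Fin 4) :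
    partialDeriv μ (fun y => c • f y) x = c • partialDeriv μ f x := by
  simp only [partialDeriv, fderiv_fun_const_smul hf, smul_apply]

theorem partialDeriv_clm_comp {W : Type*} [NormedAddCommGroup W] [NormedSpace ℝ W] (L : V →L[ℝ] W)
    (hf : DifferentiableAt ℝ f x) (μ : Fin 4) :
    partialDeriv μ (fun y => L (f y)) x = L (partialDeriv μ f x) := by
  have h := (L.hasFDerivAt.comp x hf.hasFDerivAt).fderiv
  exact congrArg (fun D : Spacetime →L[ℝ] W => D (Pi.single μ 1)) h

theorem partialDeriv_coord (μ ν : Fin 4) :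
    partialDeriv μ (fun y : Spacetime => y ν) x = if μ = ν then 1 else 0 := by
  have h : HasFDerivAt (fun y : Spacetime => y ν)
      (ContinuousLinearMap.proj (R := ℝ) (φ := fun _ : Fin 4 => ℝ) ν) x :=
    (ContinuousLinearMap.proj (R := ℝ) (φ := fun _ : Fin 4 => ℝ) ν).hasFDerivAt
  simp [partialDeriv, h.fderiv, Pi.single_apply, eq_comm]

theorem partialDeriv_comm (hf : ContDiff ℝ ∞ f) (μ ν : Fin 4) :
    partialDeriv μ (partialDeriv ν f) x = partialDeriv ν (partialDeriv μ f) x := by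
  have hf' : DifferentiableAt ℝ (fderiv ℝ f) x :=
    (hf.fderiv_right (m := ∞) le_rfl).differentiable (by simp) x
  have hsymm : IsSymmSndFDerivAt ℝ f x := hf.contDiffAt.isSymmSndFDerivAt (by
    simpa using WithTop.coe_le_coe.2 (le_top (a := (2 : ℕ∞))))
  have happly (κ : Fin 4) (v : Spacetime) :
      fderiv ℝ (fun y => fderiv ℝ f y (Pi.single κ 1)) x v = fderiv ℝ (fderiv ℝ f) x v
        (Pi.single κ 1) := by
    rw [fderiv_clm_apply hf' (differentiableAt_const _)]
    simp
  exact (happly ν _).trans ((hsymm.eq _ _).trans (happly μ _).symm)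

theorem fderiv_apply_eq_sum_partialDeriv (v : Spacetime) :
    fderiv ℝ f x v = ∑ ν, v ν • partialDeriv ν f x := by
  conv_lhs => rw [pi_eq_sum_univ' v, map_sum]
  simp only [map_smul, partialDeriv]

theorem partialDeriv_comp_affine (hf : ContDiff ℝ ∞ f) (M : Matrix (Fin 4) (Fin 4) ℝ)
    (c : Spacetime) (μ : Fin 4) :
    partialDeriv μ (fun y => f (M.mulVec y + c)) x
      = ∑ ν, M ν μ • partialDeriv ν f (M.mulVec x + c) := by
  have hM : HasFDerivAt (fun y : Spacetime => M.mulVec y + c)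
      (LinearMap.toContinuousLinearMap M.mulVecLin) x :=
    (LinearMap.toContinuousLinearMap M.mulVecLin).hasFDerivAt.add_const c
  have hcomp := ((differentiableAt_of_smooth hf).hasFDerivAt.comp x hM).fderiv
  calc partialDeriv μ (fun y => f (M.mulVec y + c)) x
      = fderiv ℝ f (M.mulVec x + c) (M.mulVec (Pi.single μ 1)) :=
        congrArg (fun D : Spacetime →L[ℝ] V => D (Pi.single μ 1)) hcomp
    _ = ∑ ν, M ν μ • partialDeriv ν f (M.mulVec x + c) := by
        simp [fderiv_apply_eq_sum_partialDeriv]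

end PartialDeriv

section GaugeDeriv

variable {V : Type*} [NormedAddCommGroup V] [InnerProductSpace ℝ V] {J : V →L[ℝ] V}
  {A : Fin 4 → Spacetime → ℝ} {f g : Spacetime → V} {x : Spacetime}

/-- The covariant derivative `D_μ f = ∂_μ f - A_μ J f` of a field with values in `V`, on which the
gauge group acts through its infinitesimal generator `J`. -/
def gaugeDeriv (J : V →L[ℝ] V) (A : Fin 4 → Spacetime → ℝ) (μ : Fin 4) (f : Spacetime → V)
    (x : Spacetime) : V :=
  partialDeriv μ f x - A μ x • J (f x)

/-- The field strength `F_{μν} = ∂_μ A_ν - ∂_ν A_μ` of a potential. -/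
def faraday (A : Fin 4 → Spacetime → ℝ) (μ ν : Fin 4) (x : Spacetime) : ℝ :=
  partialDeriv μ (A ν) x - partialDeriv ν (A μ) x

/-- The covariant exterior derivative `D_μ W_ν - D_ν W_μ` of a covector field. -/
def gaugeCurl (J : V →L[ℝ] V) (A : Fin 4 → Spacetime → ℝ) (W : Fin 4 → Spacetime → V)
    (μ ν : Fin 4) (x : Spacetime) : V :=
  gaugeDeriv J A μ (W ν) x - gaugeDeriv J A ν (W μ) x

/-- The covariant divergence `D^μ W_μ` of a covector field. -/
def gaugeDiv (J : V →L[ℝ] V) (A : Fin 4 → Spacetime → ℝ) (W : Fin 4 → Spacetime → V)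
    (x : Spacetime) : V :=
  ∑ μ, eta μ • gaugeDeriv J A μ (W μ) x

/-- The divergence `∂^μ j_μ` of a covector field. -/
def divergence (j : Fin 4 → Spacetime → V) (x : Spacetime) : V :=
  ∑ μ, eta μ • partialDeriv μ (j μ) x

theorem gaugeDeriv_zero (μ : Fin 4) : gaugeDeriv (0 : V →L[ℝ] V) A μ f = partialDeriv μ f := by
  funext x
  simp [gaugeDeriv]

theorem gaugeCurl_zero (a : Fin 4 → Spacetime → ℝ) : gaugeCurl (0 : ℝ →L[ℝ] ℝ) A a = faraday a := by
  funext μ ν x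
  simp only [gaugeCurl, faraday, gaugeDeriv_zero]

theorem gaugeDiv_zero (j : Fin 4 → Spacetime → V) :
    gaugeDiv (0 : V →L[ℝ] V) A j = divergence j := by
  funext x
  simp only [gaugeDiv, divergence, gaugeDeriv_zero]

theorem contDiff_gaugeDeriv (hA : ∀ μ, ContDiff ℝ ∞ (A μ)) (hf : ContDiff ℝ ∞ f) (μ : Fin 4) :
    ContDiff ℝ ∞ (gaugeDeriv J A μ f) :=
  (contDiff_partialDeriv hf μ).sub ((hA μ).smul (J.contDiff.comp hf))

theorem gaugeDeriv_sub (hf : DifferentiableAt ℝ f x) (hg : DifferentiableAt ℝ g x) (μ : Fin 4) :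
    gaugeDeriv J A μ (fun y => f y - g y) x = gaugeDeriv J A μ f x - gaugeDeriv J A μ g x := by
  simp only [gaugeDeriv, partialDeriv_sub hf hg, map_sub]
  module

theorem gaugeDeriv_const_smul (c : ℝ) (hf : DifferentiableAt ℝ f x) (μ : Fin 4) :
    gaugeDeriv J A μ (fun y => c • f y) x = c • gaugeDeriv J A μ f x := by
  simp only [gaugeDeriv, partialDeriv_const_smul c hf, map_smul]
  module

theorem gaugeDeriv_neg (hf : DifferentiableAt ℝ f x) (μ : Fin 4) :
    gaugeDeriv J A μ (fun y => -f y) x = -gaugeDeriv J A μ f x := by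
  simpa using gaugeDeriv_const_smul (J := J) (A := A) (-1) hf μ

theorem gaugeDeriv_sum {ι : Type*} (s : Finset ι) {F : ι → Spacetime → V}
    (hF : ∀ i ∈ s, DifferentiableAt ℝ (F i) x) (μ : Fin 4) :
    gaugeDeriv J A μ (fun y => ∑ i ∈ s, F i y) x = ∑ i ∈ s, gaugeDeriv J A μ (F i) x := by
  simp only [gaugeDeriv, partialDeriv_sum s hF, map_sum, Finset.smul_sum, Finset.sum_sub_distrib]

theorem gaugeDeriv_comm (hA : ∀ μ, ContDiff ℝ ∞ (A μ)) (hf : ContDiff ℝ ∞ f) (μ ν : Fin 4) :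
    gaugeDeriv J A μ (gaugeDeriv J A ν f) x - gaugeDeriv J A ν (gaugeDeriv J A μ f) x
      = -faraday A μ ν x • J (f x) := by
  have hJf : DifferentiableAt ℝ (fun y => J (f y)) x :=
    J.differentiableAt.comp x (differentiableAt_of_smooth hf)
  have hdd (μ ν : Fin 4) : partialDeriv μ (gaugeDeriv J A ν f) x
      = partialDeriv μ (partialDeriv ν f) x
        - (A ν x • J (partialDeriv μ f x) + partialDeriv μ (A ν) x • J (f x)) := by
    have hAν := differentiableAt_of_smooth (x := x) (hA ν)
    rw [← partialDeriv_clm_comp J (differentiableAt_of_smooth hf), ← partialDeriv_smul hAν hJf]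
    exact partialDeriv_sub (differentiableAt_of_smooth (contDiff_partialDeriv hf ν))
      (hAν.smul hJf) μ
  simp only [gaugeDeriv.eq_1 J A _ (gaugeDeriv _ _ _ _), hdd, partialDeriv_comm hf μ ν, faraday]
  simp only [gaugeDeriv, map_sub, map_smul]
  module

theorem gaugeCurl_antisymm (W : Fin 4 → Spacetime → V) (μ ν : Fin 4) :
    gaugeCurl J A W μ ν = fun y => -gaugeCurl J A W ν μ y := by
  funext y
  simp only [gaugeCurl, neg_sub]

theorem contDiff_gaugeCurl (hA : ∀ μ, ContDiff ℝ ∞ (A μ)) {W : Fin 4 → Spacetime → V}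
    (hW : ∀ μ, ContDiff ℝ ∞ (W μ)) (μ ν : Fin 4) : ContDiff ℝ ∞ (gaugeCurl J A W μ ν) :=
  (contDiff_gaugeDeriv hA (hW ν) μ).sub (contDiff_gaugeDeriv hA (hW μ) ν)

theorem contDiff_faraday (hA : ∀ μ, ContDiff ℝ ∞ (A μ)) (μ ν : Fin 4) :
    ContDiff ℝ ∞ (faraday A μ ν) :=
  gaugeCurl_zero (A := A) A ▸ contDiff_gaugeCurl hA hA μ ν

theorem bianchi_gaugeCurl (hA : ∀ μ, ContDiff ℝ ∞ (A μ)) {W : Fin 4 → Spacetime → V}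
    (hW : ∀ μ, ContDiff ℝ ∞ (W μ)) (μ ν ρ : Fin 4) :
    gaugeDeriv J A ν (gaugeCurl J A W μ ρ) x + gaugeDeriv J A μ (gaugeCurl J A W ρ ν) x
        + gaugeDeriv J A ρ (gaugeCurl J A W ν μ) x
      = -(faraday A ν μ x • J (W ρ x) + faraday A μ ρ x • J (W ν x)
        + faraday A ρ ν x • J (W μ x)) := by
  have hcurl (κ α β : Fin 4) : gaugeDeriv J A κ (gaugeCurl J A W α β) x
      = gaugeDeriv J A κ (gaugeDeriv J A α (W β)) x
        - gaugeDeriv J A κ (gaugeDeriv J A β (W α)) x :=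
    gaugeDeriv_sub (differentiableAt_of_smooth (contDiff_gaugeDeriv hA (hW β) α))
      (differentiableAt_of_smooth (contDiff_gaugeDeriv hA (hW α) β)) κ
  rw [hcurl, hcurl, hcurl]
  linear_combination (norm := module) gaugeDeriv_comm (x := x) (J := J) hA (hW ρ) ν μ
    + gaugeDeriv_comm (x := x) (J := J) hA (hW ν) μ ρ
    + gaugeDeriv_comm (x := x) (J := J) hA (hW μ) ρ ν

theorem partialDeriv_inner (hJ : ∀ v w, ⟪J v, w⟫ = -⟪v, J w⟫)
    (hf : DifferentiableAt ℝ f x) (hg : DifferentiableAt ℝ g x) (μ : Fin 4) :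
    partialDeriv μ (fun y => ⟪f y, g y⟫) x
      = ⟪gaugeDeriv J A μ f x, g x⟫ + ⟪f x, gaugeDeriv J A μ g x⟫ := by
  simp only [partialDeriv, fderiv_inner_apply ℝ hf hg, gaugeDeriv, inner_sub_left, inner_sub_right,
    real_inner_smul_left, real_inner_smul_right, hJ]
  ring

end GaugeDeriv

section Contraction

variable {V : Type*} [NormedAddCommGroup V] [InnerProductSpace ℝ V]

/-- The Minkowski contraction `η^{μν} ⟪a_μ, b_ν⟫` of two covectors with values in `V`. -/
def etaInner (a b : Fin 4 → V) : ℝ := ∑ μ, eta μ * ⟪a μ, b μ⟫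

/-- The Minkowski contraction `η^{μρ} η^{νσ} ⟪G_{μν}, H_{ρσ}⟫` of two tensors with values in `V`. -/
def etaInner₂ (G H : Fin 4 → Fin 4 → V) : ℝ := ∑ μ, eta μ * etaInner (G μ) (H μ)

/-- The entry `η_{μν}` of the Minkowski metric. -/
def metric (μ ν : Fin 4) : ℝ := if μ = ν then eta μ else 0

theorem eta_mul_self (μ : Fin 4) : eta μ * eta μ = 1 := by
  fin_cases μ <;> norm_num [eta]

theorem sum_eta_mul_metric (ν : Fin 4) (c : Fin 4 → ℝ) :
    ∑ μ, eta μ * (metric μ ν * c μ) = c ν := by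
  simp only [metric, ite_mul, zero_mul, mul_ite, mul_zero, Finset.sum_ite_eq', Finset.mem_univ,
    if_true, ← mul_assoc, eta_mul_self, one_mul]

theorem etaInner_comm (a b : Fin 4 → V) : etaInner a b = etaInner b a := by
  simp only [etaInner, real_inner_comm]

theorem etaInner₂_comm (G H : Fin 4 → Fin 4 → V) : etaInner₂ G H = etaInner₂ H G := by
  simp only [etaInner₂, etaInner_comm]

theorem etaInner₂_swap (G H : Fin 4 → Fin 4 → V) :
    etaInner₂ (fun α β => G β α) (fun α β => H β α) = etaInner₂ G H := by
  simp only [etaInner₂, etaInner, Finset.mul_sum]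
  rw [Finset.sum_comm]
  exact Finset.sum_congr rfl fun _ _ => Finset.sum_congr rfl fun _ _ => mul_left_comm ..

theorem etaInner₂_add_right (G H K : Fin 4 → Fin 4 → V) :
    etaInner₂ G (fun α β => H α β + K α β) = etaInner₂ G H + etaInner₂ G K := by
  simp only [etaInner₂, etaInner, inner_add_right, mul_add, Finset.sum_add_distrib]

theorem etaInner₂_neg_right (G H : Fin 4 → Fin 4 → V) :
    etaInner₂ G (fun α β => -H α β) = -etaInner₂ G H := by
  simp only [etaInner₂, etaInner, inner_neg_right, mul_neg, Finset.sum_neg_distrib]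

theorem etaInner_zero_right (a : Fin 4 → V) : etaInner a 0 = 0 := by
  simp [etaInner]

theorem etaInner₂_zero_right (G : Fin 4 → Fin 4 → V) : etaInner₂ G 0 = 0 := by
  simp [etaInner₂, etaInner_zero_right]

theorem etaInner₂_swap_right {G : Fin 4 → Fin 4 → V} (hG : ∀ α β, G α β = -G β α)
    (H : Fin 4 → Fin 4 → V) : etaInner₂ G (fun α β => H β α) = -etaInner₂ G H := by
  have hswap : (fun α β => G β α) = fun α β => -G α β := funext₂ fun α β => hG β α
  calc etaInner₂ G (fun α β => H β α) = etaInner₂ (fun α β => G β α) H :=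
        (etaInner₂_swap G fun α β => H β α).symm
    _ = -etaInner₂ G H := by rw [hswap, etaInner₂_comm, etaInner₂_neg_right, etaInner₂_comm]

theorem etaInner₂_sub_swap_right {G : Fin 4 → Fin 4 → V} (hG : ∀ α β, G α β = -G β α)
    (H : Fin 4 → Fin 4 → V) : etaInner₂ G (fun α β => H α β - H β α) = 2 * etaInner₂ G H := by
  simp only [sub_eq_add_neg]
  rw [etaInner₂_add_right, etaInner₂_neg_right, etaInner₂_swap_right hG H, neg_neg, two_mul]

end Contraction

section Stress

variable {V : Type*} [NormedAddCommGroup V] [InnerProductSpace ℝ V] {J : V →L[ℝ] V}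
  {A : Fin 4 → Spacetime → ℝ} {x : Spacetime}

/-- The gauge-field stress tensor `η^{ρσ} ⟪G_{μρ}, G_{νσ}⟫ - (1/4) η_{μν} G^{ρσ} G_{ρσ}`. -/
def gaugeStress (G : Fin 4 → Fin 4 → V) (μ ν : Fin 4) : ℝ :=
  etaInner (G μ) (G ν) - metric μ ν * ((1 / 4) * etaInner₂ G G)

/-- The stress tensor `⟪w_μ, w_ν⟫ - (1/2) η_{μν} w^ρ w_ρ` of the mass term. -/
def massStress (w : Fin 4 → V) (μ ν : Fin 4) : ℝ :=
  ⟪w μ, w ν⟫ - metric μ ν * ((1 / 2) * etaInner w w)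

theorem contDiff_etaInner {a b : Fin 4 → Spacetime → V} (ha : ∀ ρ, ContDiff ℝ ∞ (a ρ))
    (hb : ∀ ρ, ContDiff ℝ ∞ (b ρ)) :
    ContDiff ℝ ∞ fun y => etaInner (fun ρ => a ρ y) (fun ρ => b ρ y) :=
  ContDiff.sum fun ρ _ => contDiff_const.mul ((ha ρ).inner ℝ (hb ρ))

theorem contDiff_etaInner₂ {G H : Fin 4 → Fin 4 → Spacetime → V}
    (hG : ∀ μ ν, ContDiff ℝ ∞ (G μ ν)) (hH : ∀ μ ν, ContDiff ℝ ∞ (H μ ν)) :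
    ContDiff ℝ ∞ fun y => etaInner₂ (fun μ ν => G μ ν y) (fun μ ν => H μ ν y) :=
  ContDiff.sum fun μ _ => contDiff_const.mul (contDiff_etaInner (hG μ) (hH μ))

theorem contDiff_gaugeStress {G : Fin 4 → Fin 4 → Spacetime → V}
    (hG : ∀ μ ν, ContDiff ℝ ∞ (G μ ν)) (μ ν : Fin 4) :
    ContDiff ℝ ∞ fun y => gaugeStress (fun α β => G α β y) μ ν :=
  (contDiff_etaInner (hG μ) (hG ν)).sub
    (contDiff_const.mul (contDiff_const.mul (contDiff_etaInner₂ hG hG)))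

theorem contDiff_massStress {W : Fin 4 → Spacetime → V} (hW : ∀ μ, ContDiff ℝ ∞ (W μ))
    (μ ν : Fin 4) : ContDiff ℝ ∞ fun y => massStress (fun α => W α y) μ ν :=
  ((hW μ).inner ℝ (hW ν)).sub
    (contDiff_const.mul (contDiff_const.mul (contDiff_etaInner hW hW)))

theorem partialDeriv_etaInner (hJ : ∀ v w, ⟪J v, w⟫ = -⟪v, J w⟫) {a b : Fin 4 → Spacetime → V}
    (ha : ∀ ρ, ContDiff ℝ ∞ (a ρ)) (hb : ∀ ρ, ContDiff ℝ ∞ (b ρ)) (μ : Fin 4) :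
    partialDeriv μ (fun y => etaInner (fun ρ => a ρ y) (fun ρ => b ρ y)) x
      = etaInner (fun ρ => gaugeDeriv J A μ (a ρ) x) (fun ρ => b ρ x)
        + etaInner (fun ρ => a ρ x) (fun ρ => gaugeDeriv J A μ (b ρ) x) := by
  have hterm (ρ : Fin 4) : ContDiff ℝ ∞ fun y => ⟪a ρ y, b ρ y⟫ := (ha ρ).inner ℝ (hb ρ)
  simp only [etaInner, ← Finset.sum_add_distrib, ← mul_add]
  rw [partialDeriv_sum _ fun ρ _ => differentiableAt_of_smooth (contDiff_const.mul (hterm ρ))]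
  refine Finset.sum_congr rfl fun ρ _ => ?_
  rw [← partialDeriv_inner hJ (differentiableAt_of_smooth (ha ρ))
    (differentiableAt_of_smooth (hb ρ))]
  exact partialDeriv_const_smul (eta ρ) (differentiableAt_of_smooth (hterm ρ)) μ

theorem partialDeriv_etaInner₂ (hJ : ∀ v w, ⟪J v, w⟫ = -⟪v, J w⟫)
    {G H : Fin 4 → Fin 4 → Spacetime → V} (hG : ∀ μ ν, ContDiff ℝ ∞ (G μ ν))
    (hH : ∀ μ ν, ContDiff ℝ ∞ (H μ ν)) (μ : Fin 4) :
    partialDeriv μ (fun y => etaInner₂ (fun α β => G α β y) (fun α β => H α β y)) x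
      = etaInner₂ (fun α β => gaugeDeriv J A μ (G α β) x) (fun α β => H α β x)
        + etaInner₂ (fun α β => G α β x) (fun α β => gaugeDeriv J A μ (H α β) x) := by
  have hterm (ρ : Fin 4) := contDiff_etaInner (hG ρ) (hH ρ)
  simp only [etaInner₂, ← Finset.sum_add_distrib, ← mul_add]
  rw [partialDeriv_sum _ fun ρ _ => differentiableAt_of_smooth (contDiff_const.mul (hterm ρ))]
  refine Finset.sum_congr rfl fun ρ _ => ?_
  rw [← partialDeriv_etaInner hJ (hG ρ) (hH ρ)]
  exact partialDeriv_const_smul (eta ρ) (differentiableAt_of_smooth (hterm ρ)) μ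

theorem divergence_sub_metric_mul {B : Fin 4 → Spacetime → ℝ} {q : Spacetime → ℝ}
    (hB : ∀ μ, ContDiff ℝ ∞ (B μ)) (hq : ContDiff ℝ ∞ q) (c : ℝ) (ν : Fin 4) :
    divergence (fun μ y => B μ y - metric μ ν * (c * q y)) x
      = divergence B x - c * partialDeriv ν q x := by
  have hterm (μ : Fin 4) : partialDeriv μ (fun y => B μ y - metric μ ν * (c * q y)) x
      = partialDeriv μ (B μ) x - metric μ ν * (c * partialDeriv μ q x) := by
    have hq' := differentiableAt_of_smooth (x := x) hq
    rw [partialDeriv_sub (differentiableAt_of_smooth (hB μ))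
      (differentiableAt_of_smooth (contDiff_const.mul (contDiff_const.mul hq)))]
    simp only [← mul_assoc]
    exact congrArg _ (partialDeriv_const_smul (metric μ ν * c) hq' μ)
  simp only [divergence, hterm, smul_eq_mul, mul_sub, Finset.sum_sub_distrib, sum_eta_mul_metric]

theorem divergence_massStress (hJ : ∀ v w, ⟪J v, w⟫ = -⟪v, J w⟫) {W : Fin 4 → Spacetime → V}
    (hW : ∀ μ, ContDiff ℝ ∞ (W μ)) (ν : Fin 4) :
    divergence (fun μ y => massStress (fun α => W α y) μ ν) x
      = ⟪gaugeDiv J A W x, W ν x⟫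
        + etaInner (fun μ => W μ x) (fun μ => gaugeCurl J A W μ ν x) := by
  have hquad : partialDeriv ν (fun y => etaInner (fun ρ => W ρ y) (fun ρ => W ρ y)) x
      = 2 * etaInner (fun ρ => W ρ x) (fun ρ => gaugeDeriv J A ν (W ρ) x) := by
    rw [partialDeriv_etaInner (A := A) hJ hW hW, etaInner_comm, two_mul]
  have hinner (μ : Fin 4) := partialDeriv_inner (A := A) hJ (differentiableAt_of_smooth (x := x)
    (hW μ)) (differentiableAt_of_smooth (hW ν)) μ
  refine (divergence_sub_metric_mul (fun μ => (hW μ).inner ℝ (hW ν)) (contDiff_etaInner hW hW)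
    (1 / 2) ν).trans ?_
  rw [hquad]
  simp only [divergence, hinner, gaugeDiv, etaInner, gaugeCurl, sum_inner, real_inner_smul_left,
    inner_sub_right, smul_eq_mul, mul_add, mul_sub, Finset.sum_add_distrib, Finset.sum_sub_distrib]
  ring

theorem divergence_etaInner (hJ : ∀ v w, ⟪J v, w⟫ = -⟪v, J w⟫)
    {G : Fin 4 → Fin 4 → Spacetime → V} {a : Fin 4 → Spacetime → V}
    (hG : ∀ μ ν, ContDiff ℝ ∞ (G μ ν)) (ha : ∀ ν, ContDiff ℝ ∞ (a ν)) :
    divergence (fun μ y => etaInner (fun ρ => G μ ρ y) (fun ρ => a ρ y)) x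
      = etaInner (fun ρ => gaugeDiv J A (fun μ => G μ ρ) x) (fun ρ => a ρ x)
        + etaInner₂ (fun μ ρ => G μ ρ x) (fun μ ρ => gaugeDeriv J A μ (a ρ) x) := by
  simp only [divergence, partialDeriv_etaInner (A := A) hJ (hG _) ha, etaInner₂, smul_eq_mul,
    mul_add, Finset.sum_add_distrib, add_left_inj]
  simp only [etaInner, gaugeDiv, sum_inner, real_inner_smul_left, Finset.mul_sum]
  rw [Finset.sum_comm]
  exact Finset.sum_congr rfl fun _ _ => Finset.sum_congr rfl fun _ _ => mul_left_comm ..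

theorem divergence_gaugeStress (hJ : ∀ v w, ⟪J v, w⟫ = -⟪v, J w⟫)
    {G : Fin 4 → Fin 4 → Spacetime → V} (hG : ∀ μ ν, ContDiff ℝ ∞ (G μ ν))
    (hanti : ∀ μ ν, G μ ν = fun y => -G ν μ y) (ν : Fin 4) :
    divergence (fun μ y => gaugeStress (fun α β => G α β y) μ ν) x
      = etaInner (fun ρ => gaugeDiv J A (fun μ => G μ ρ) x) (fun ρ => G ν ρ x)
        - (1 / 2) * etaInner₂ (fun μ ρ => G μ ρ x) (fun μ ρ => gaugeDeriv J A ν (G μ ρ) x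
          + gaugeDeriv J A μ (G ρ ν) x + gaugeDeriv J A ρ (G ν μ) x) := by
  have hquad : partialDeriv ν
        (fun y => etaInner₂ (fun α β => G α β y) (fun α β => G α β y)) x
      = 2 * etaInner₂ (fun α β => G α β x) (fun α β => gaugeDeriv J A ν (G α β) x) := by
    rw [partialDeriv_etaInner₂ (A := A) hJ hG hG, etaInner₂_comm, two_mul]
  have hD (μ ρ : Fin 4) : gaugeDeriv J A μ (G ρ ν) x = -gaugeDeriv J A μ (G ν ρ) x := by
    rw [hanti ρ ν, gaugeDeriv_neg (differentiableAt_of_smooth (hG ν ρ))]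
  have hswap := etaInner₂_swap_right (fun α β => congrFun (hanti α β) x)
    (fun μ ρ => gaugeDeriv J A μ (G ν ρ) x)
  refine (divergence_sub_metric_mul (fun μ => contDiff_etaInner (hG μ) (hG ν))
    (contDiff_etaInner₂ hG hG) (1 / 4) ν).trans ?_
  rw [divergence_etaInner (A := A) hJ hG (hG ν), hquad, etaInner₂_add_right, etaInner₂_add_right,
    hswap]
  simp only [hD, etaInner₂_neg_right]
  ring

end Stress

section DoubleDivergence

variable {V : Type*} [NormedAddCommGroup V] [InnerProductSpace ℝ V] {J : V →L[ℝ] V}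
  {A : Fin 4 → Spacetime → ℝ}

theorem gaugeDeriv_gaugeDiv (hA : ∀ μ, ContDiff ℝ ∞ (A μ)) {W : Fin 4 → Spacetime → V}
    (hW : ∀ μ, ContDiff ℝ ∞ (W μ)) (ν : Fin 4) (x : Spacetime) :
    gaugeDeriv J A ν (gaugeDiv J A W) x
      = ∑ μ, eta μ • gaugeDeriv J A ν (gaugeDeriv J A μ (W μ)) x := by
  have hDW (μ : Fin 4) := contDiff_gaugeDeriv (J := J) hA (hW μ) μ
  refine (gaugeDeriv_sum _ (fun μ _ =>
    differentiableAt_of_smooth ((hDW μ).const_smul (eta μ))) ν).trans ?_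
  exact Finset.sum_congr rfl fun μ _ =>
    gaugeDeriv_const_smul (eta μ) (differentiableAt_of_smooth (hDW μ)) ν

theorem divergence_sub {j k : Fin 4 → Spacetime → ℝ} (hj : ∀ μ, ContDiff ℝ ∞ (j μ))
    (hk : ∀ μ, ContDiff ℝ ∞ (k μ)) (x : Spacetime) :
    divergence (fun μ y => j μ y - k μ y) x = divergence j x - divergence k x := by
  simp only [divergence, partialDeriv_sub (differentiableAt_of_smooth (hj _))
    (differentiableAt_of_smooth (hk _)), smul_sub, Finset.sum_sub_distrib]

theorem divergence_const_mul (c : ℝ) {j : Fin 4 → Spacetime → ℝ} (hj : ∀ μ, ContDiff ℝ ∞ (j μ))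
    (x : Spacetime) : divergence (fun μ y => c * j μ y) x = c * divergence j x := by
  have hterm (μ : Fin 4) : partialDeriv μ (fun y => c * j μ y) x = c * partialDeriv μ (j μ) x :=
    partialDeriv_const_smul c (differentiableAt_of_smooth (hj μ)) μ
  simp only [divergence, hterm, smul_eq_mul, Finset.mul_sum, mul_left_comm]

theorem inner_gaugeDiv_gaugeDiv (hJ : ∀ v w, ⟪J v, w⟫ = -⟪v, J w⟫)
    (hA : ∀ μ, ContDiff ℝ ∞ (A μ)) {G : Fin 4 → Fin 4 → Spacetime → V}
    (hG : ∀ μ ν, ContDiff ℝ ∞ (G μ ν)) (hanti : ∀ μ ν, G μ ν = fun y => -G ν μ y)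
    (x : Spacetime) (v : V) :
    ⟪gaugeDiv J A (fun ν => gaugeDiv J A fun μ => G μ ν) x, v⟫
      = -(1 / 2) * etaInner₂ (fun μ ν => G μ ν x) (fun μ ν => faraday A μ ν x • J v) := by
  set DD : Fin 4 → Fin 4 → V := fun ν μ => gaugeDeriv J A ν (gaugeDeriv J A μ (G μ ν)) x
  have hDD : ⟪gaugeDiv J A (fun ν => gaugeDiv J A fun μ => G μ ν) x, v⟫
      = etaInner₂ (fun _ _ => v) DD := by
    rw [real_inner_comm]
    simp only [gaugeDiv.eq_1 J A (fun _ => gaugeDiv _ _ _), gaugeDeriv_gaugeDiv hA (hG · _),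
      inner_sum, real_inner_smul_right, etaInner₂, etaInner, DD]
  have hcomm (ν μ : Fin 4) : DD ν μ + DD μ ν = faraday A ν μ x • J (G ν μ x) := by
    have hneg : gaugeDeriv J A ν (G ν μ) = fun y => -gaugeDeriv J A ν (G μ ν) y := by
      funext y
      rw [hanti ν μ, gaugeDeriv_neg (differentiableAt_of_smooth (hG μ ν))]
    have hDDμν : DD μ ν = -gaugeDeriv J A μ (gaugeDeriv J A ν (G μ ν)) x := by
      simp only [DD, hneg]
      exact gaugeDeriv_neg (differentiableAt_of_smooth (contDiff_gaugeDeriv hA (hG μ ν) ν)) μ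
    rw [hDDμν, ← sub_eq_add_neg, gaugeDeriv_comm hA (hG μ ν), hanti ν μ, map_neg]
    module
  have hswap := etaInner₂_swap (fun _ _ => v) DD
  have hadd := etaInner₂_add_right (fun _ _ => v) DD (fun ν μ => DD μ ν)
  have hmove : etaInner₂ (fun _ _ => v) (fun ν μ => faraday A ν μ x • J (G ν μ x))
      = -etaInner₂ (fun μ ν => G μ ν x) (fun μ ν => faraday A μ ν x • J v) := by
    rw [etaInner₂_comm, ← etaInner₂_neg_right]
    simp only [etaInner₂, etaInner, real_inner_smul_left, hJ, inner_neg_right,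
      real_inner_smul_right, mul_neg]
  simp only [hcomm, hmove] at hadd
  linarith

end DoubleDivergence

section SpatialTrace

variable {V : Type*} [NormedAddCommGroup V] [InnerProductSpace ℝ V]

theorem etaInner_self (w : Fin 4 → V) :
    etaInner w w = ‖w 0‖ ^ 2 - ∑ i : Fin 3, ‖w i.succ‖ ^ 2 := by
  simp only [etaInner, Fin.sum_univ_succ, real_inner_self_eq_norm_sq]
  simp [eta]
  ring

theorem etaInner₂_self {G : Fin 4 → Fin 4 → V} (hG : ∀ μ ν, G μ ν = -G ν μ) :
    etaInner₂ G G = (∑ i : Fin 3, ∑ j : Fin 3, ‖G i.succ j.succ‖ ^ 2)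
      - 2 * ∑ i : Fin 3, ‖G 0 i.succ‖ ^ 2 := by
  have := IsAddTorsionFree.of_isTorsionFree ℝ V
  have hdiag : G 0 0 = 0 := self_eq_neg.mp (hG 0 0)
  have hside (i : Fin 3) : ‖G i.succ 0‖ = ‖G 0 i.succ‖ := by rw [hG, norm_neg]
  have heta (i : Fin 3) : eta i.succ = -1 := by fin_cases i <;> simp [eta]
  simp only [etaInner₂, etaInner_self, Fin.sum_univ_succ (n := 3), heta, hdiag, hside,
    neg_one_mul, neg_sub, Finset.sum_sub_distrib]
  simp [eta]
  ring

theorem sum_massStress_self (w : Fin 4 → V) :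
    ∑ k : Fin 3, massStress w k.succ k.succ
      = (3 / 2) * ‖w 0‖ ^ 2 - (1 / 2) * ∑ k : Fin 3, ‖w k.succ‖ ^ 2 := by
  simp only [massStress, metric, if_true, real_inner_self_eq_norm_sq, etaInner_self,
    Fin.sum_univ_three]
  simp [eta]
  ring

theorem sum_gaugeStress_self {G : Fin 4 → Fin 4 → V} (hG : ∀ μ ν, G μ ν = -G ν μ) :
    ∑ k : Fin 3, gaugeStress G k.succ k.succ
      = -(1 / 2) * (∑ i : Fin 3, ‖G 0 i.succ‖ ^ 2)
        - (1 / 4) * ∑ i : Fin 3, ∑ j : Fin 3, ‖G i.succ j.succ‖ ^ 2 := by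
  have hside (i : Fin 3) : ‖G i.succ 0‖ = ‖G 0 i.succ‖ := by rw [hG, norm_neg]
  simp only [gaugeStress, metric, if_true, etaInner₂_self hG, etaInner_self, hside,
    Fin.sum_univ_three]
  simp [eta]
  ring

end SpatialTrace

section RadialCurrent

/-- The current `x^k S_{μk}` obtained by contracting a stress tensor with the spatial position
vector. -/
def radialCurrent (S : Spacetime → Fin 4 → Fin 4 → ℝ) (μ : Fin 4) (y : Spacetime) : ℝ :=
  ∑ k : Fin 3, y k.succ * S y μ k.succ

theorem contDiff_radialCurrent {S : Spacetime → Fin 4 → Fin 4 → ℝ}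
    (hS : ∀ μ ν, ContDiff ℝ ∞ fun y => S y μ ν) (μ : Fin 4) :
    ContDiff ℝ ∞ (radialCurrent S μ) :=
  ContDiff.sum fun k _ => (contDiff_apply ℝ ℝ k.succ).mul (hS μ k.succ)

theorem divergence_radialCurrent {S : Spacetime → Fin 4 → Fin 4 → ℝ}
    (hS : ∀ μ ν, ContDiff ℝ ∞ fun y => S y μ ν) (x : Spacetime) :
    divergence (radialCurrent S) x
      = ∑ k : Fin 3, (x k.succ * divergence (fun μ y => S y μ k.succ) x - S x k.succ k.succ) := by
  have hcoord (k : Fin 3) : ContDiff ℝ ∞ fun y : Spacetime => y k.succ := contDiff_apply ℝ ℝ _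
  have hterm (μ : Fin 4) : partialDeriv μ (radialCurrent S μ) x
      = ∑ k : Fin 3, (x k.succ * partialDeriv μ (fun y => S y μ k.succ) x
        + (if μ = k.succ then 1 else 0) * S x μ k.succ) := by
    refine (partialDeriv_sum _ (fun k _ => differentiableAt_of_smooth
      ((hcoord k).mul (hS μ k.succ))) μ).trans (Finset.sum_congr rfl fun k _ => ?_)
    rw [← partialDeriv_coord (x := x)]
    exact partialDeriv_smul (differentiableAt_of_smooth (hcoord k))
      (differentiableAt_of_smooth (hS μ k.succ)) μ
  have heta (k : Fin 3) : eta k.succ = -1 := by fin_cases k <;> simp [eta]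
  simp only [divergence, hterm, Finset.smul_sum]
  rw [Finset.sum_comm]
  refine Finset.sum_congr rfl fun k _ => ?_
  simp only [smul_eq_mul, mul_add, Finset.sum_add_distrib, ite_mul, one_mul, zero_mul, mul_ite,
    mul_zero, Finset.sum_ite_eq', Finset.mem_univ, if_true, heta, Finset.mul_sum, neg_mul,
    ← sub_eq_add_neg]
  congr 1
  exact Finset.sum_congr rfl fun _ _ => mul_left_comm ..

end RadialCurrent

section ProcaMaxwell

variable {V : Type*} [NormedAddCommGroup V] [InnerProductSpace ℝ V] {J : V →L[ℝ] V} {m : ℝ}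
  {A : Fin 4 → Spacetime → ℝ} {W : Fin 4 → Spacetime → V}

/-- Smooth solutions of the field equations `D^μ W_{μν} + m² W_ν = 0` and
`∂^μ F_{μρ} = 2 ⟪J W_{ρσ}, W^σ⟫` of a Proca field `W` of mass `m` coupled through the generator `J`
to the Maxwell potential `A`. -/
structure IsProcaMaxwell (J : V →L[ℝ] V) (m : ℝ) (A : Fin 4 → Spacetime → ℝ)
    (W : Fin 4 → Spacetime → V) : Prop where
  contDiff_potential : ∀ μ, ContDiff ℝ ∞ (A μ)
  contDiff_field : ∀ μ, ContDiff ℝ ∞ (W μ)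
  proca : ∀ ν x, gaugeDiv J A (fun μ => gaugeCurl J A W μ ν) x = -(m ^ 2 • W ν x)
  maxwell : ∀ ρ x, divergence (fun μ => faraday A μ ρ) x
    = 2 * etaInner (fun σ => J (gaugeCurl J A W ρ σ x)) (fun σ => W σ x)

/-- The conserved stress tensor of the coupled system. -/
def stress (J : V →L[ℝ] V) (m : ℝ) (A : Fin 4 → Spacetime → ℝ) (W : Fin 4 → Spacetime → V)
    (x : Spacetime) (μ ν : Fin 4) : ℝ :=
  2 * m ^ 2 * massStress (fun α => W α x) μ ν
    - 2 * gaugeStress (fun α β => gaugeCurl J A W α β x) μ ν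
    - gaugeStress (fun α β => faraday A α β x) μ ν

/-- The virial current `W_{μρ} W^ρ`. -/
def virialCurrent (J : V →L[ℝ] V) (A : Fin 4 → Spacetime → ℝ) (W : Fin 4 → Spacetime → V)
    (μ : Fin 4) (x : Spacetime) : ℝ :=
  etaInner (fun ρ => gaugeCurl J A W μ ρ x) (fun ρ => W ρ x)

/-- The virial current corrected by the current of spatial dilations; the coefficients are such that
all contributions of indefinite sign to the divergence cancel. -/
def dilationCurrent (J : V →L[ℝ] V) (m : ℝ) (A : Fin 4 → Spacetime → ℝ)
    (W : Fin 4 → Spacetime → V) (μ : Fin 4) (x : Spacetime) : ℝ :=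
  virialCurrent J A W μ x - radialCurrent (stress J m A W) μ x

theorem faraday_antisymm (μ ν : Fin 4) : faraday A μ ν = fun y => -faraday A ν μ y := by
  funext y
  simp only [faraday, neg_sub]

theorem sum_stress_self (x : Spacetime) :
    ∑ k : Fin 3, stress J m A W x k.succ k.succ
      = m ^ 2 * (3 * ‖W 0 x‖ ^ 2 - ∑ i : Fin 3, ‖W i.succ x‖ ^ 2)
        + (∑ i : Fin 3, ‖gaugeCurl J A W 0 i.succ x‖ ^ 2)
        + (1 / 2) * (∑ i : Fin 3, ∑ j : Fin 3, ‖gaugeCurl J A W i.succ j.succ x‖ ^ 2)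
        + (1 / 2) * (∑ i : Fin 3, ‖faraday A 0 i.succ x‖ ^ 2)
        + (1 / 4) * ∑ i : Fin 3, ∑ j : Fin 3, ‖faraday A i.succ j.succ x‖ ^ 2 := by
  simp only [stress, Finset.sum_sub_distrib, ← Finset.mul_sum, sum_massStress_self,
    sum_gaugeStress_self fun μ ν => congrFun (gaugeCurl_antisymm (J := J) (A := A) W μ ν) x,
    sum_gaugeStress_self fun μ ν => congrFun (faraday_antisymm (A := A) μ ν) x]
  ring

namespace IsProcaMaxwell

variable (h : IsProcaMaxwell J m A W)
include h

theorem contDiff_curl (μ ν : Fin 4) : ContDiff ℝ ∞ (gaugeCurl J A W μ ν) :=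
  contDiff_gaugeCurl h.contDiff_potential h.contDiff_field μ ν

theorem contDiff_faraday (μ ν : Fin 4) : ContDiff ℝ ∞ (faraday A μ ν) :=
  ChargedVector.contDiff_faraday h.contDiff_potential μ ν

theorem contDiff_stress (μ ν : Fin 4) : ContDiff ℝ ∞ fun y => stress J m A W y μ ν :=
  ((contDiff_const.mul (contDiff_massStress h.contDiff_field μ ν)).sub
    (contDiff_const.mul (contDiff_gaugeStress h.contDiff_curl μ ν))).sub
      (contDiff_gaugeStress h.contDiff_faraday μ ν)

theorem contDiff_virialCurrent (μ : Fin 4) : ContDiff ℝ ∞ (virialCurrent J A W μ) :=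
  contDiff_etaInner (h.contDiff_curl μ) h.contDiff_field

theorem contDiff_dilationCurrent (μ : Fin 4) : ContDiff ℝ ∞ (dilationCurrent J m A W μ) :=
  (h.contDiff_virialCurrent μ).sub (contDiff_radialCurrent h.contDiff_stress μ)

theorem inner_gaugeDiv (hJ : ∀ v w, ⟪J v, w⟫ = -⟪v, J w⟫) (x : Spacetime) (v : V) :
    m ^ 2 * ⟪gaugeDiv J A W x, v⟫ = (1 / 2) * etaInner₂ (fun μ ν => gaugeCurl J A W μ ν x)
      (fun μ ν => faraday A μ ν x • J v) := by
  have hdouble := inner_gaugeDiv_gaugeDiv hJ h.contDiff_potential h.contDiff_curl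
    (gaugeCurl_antisymm W) x v
  have hproca (ν : Fin 4) : gaugeDiv J A (fun μ => gaugeCurl J A W μ ν)
      = fun y => -m ^ 2 • W ν y := funext fun y => by rw [h.proca, neg_smul]
  have hmass : gaugeDiv J A (fun ν y => -m ^ 2 • W ν y) x = -m ^ 2 • gaugeDiv J A W x := by
    simp only [gaugeDiv, gaugeDeriv_const_smul _ (differentiableAt_of_smooth
      (h.contDiff_field _)), Finset.smul_sum, smul_comm (eta _)]
  simp only [hproca, hmass, real_inner_smul_left] at hdouble
  linarith

theorem divergence_massStress (hJ : ∀ v w, ⟪J v, w⟫ = -⟪v, J w⟫) (x : Spacetime) (ν : Fin 4) :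
    m ^ 2 * divergence (fun μ y => massStress (fun α => W α y) μ ν) x
      = (1 / 2) * etaInner₂ (fun α β => gaugeCurl J A W α β x)
          (fun α β => faraday A α β x • J (W ν x))
        + m ^ 2 * etaInner (fun μ => W μ x) (fun μ => gaugeCurl J A W μ ν x) := by
  rw [ChargedVector.divergence_massStress (A := A) hJ h.contDiff_field, mul_add,
    h.inner_gaugeDiv hJ]

theorem divergence_gaugeStress_curl (hJ : ∀ v w, ⟪J v, w⟫ = -⟪v, J w⟫) (x : Spacetime)
    (ν : Fin 4) :
    divergence (fun μ y => gaugeStress (fun α β => gaugeCurl J A W α β y) μ ν) x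
      = m ^ 2 * etaInner (fun μ => W μ x) (fun μ => gaugeCurl J A W μ ν x)
        + (1 / 2) * etaInner₂ (fun α β => gaugeCurl J A W α β x)
          (fun α β => faraday A α β x • J (W ν x))
        + etaInner₂ (fun α β => gaugeCurl J A W α β x)
          (fun α β => faraday A ν α x • J (W β x)) := by
  have hproca : etaInner (fun ρ => gaugeDiv J A (fun μ => gaugeCurl J A W μ ρ) x)
        (fun ρ => gaugeCurl J A W ν ρ x)
      = m ^ 2 * etaInner (fun μ => W μ x) (fun μ => gaugeCurl J A W μ ν x) := by
    simp only [h.proca, gaugeCurl_antisymm W ν, etaInner, inner_neg_left, inner_neg_right, neg_neg,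
      real_inner_smul_left, Finset.mul_sum, mul_left_comm]
  have hswap := etaInner₂_swap_right
    (fun α β => congrFun (gaugeCurl_antisymm (J := J) (A := A) W α β) x)
    (fun α β => -(faraday A ν α x • J (W β x)))
  have hcyclic (α β : Fin 4) : -(faraday A ν α x • J (W β x) + faraday A α β x • J (W ν x)
        + faraday A β ν x • J (W α x))
      = -(faraday A ν α x • J (W β x)) + -(faraday A α β x • J (W ν x))
        + -(-(faraday A ν β x • J (W α x))) := by
    rw [faraday_antisymm β ν]
    module
  rw [ChargedVector.divergence_gaugeStress (A := A) hJ h.contDiff_curl (gaugeCurl_antisymm W),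
    hproca]
  simp only [bianchi_gaugeCurl h.contDiff_potential h.contDiff_field, hcyclic,
    etaInner₂_add_right, etaInner₂_neg_right] at hswap ⊢
  linarith

theorem divergence_gaugeStress_faraday (hJ : ∀ v w, ⟪J v, w⟫ = -⟪v, J w⟫) (x : Spacetime)
    (ν : Fin 4) :
    divergence (fun μ y => gaugeStress (fun α β => faraday A α β y) μ ν) x
      = -2 * etaInner₂ (fun α β => gaugeCurl J A W α β x)
          (fun α β => faraday A ν α x • J (W β x)) := by
  have hbianchi (μ ρ : Fin 4) := bianchi_gaugeCurl (J := (0 : ℝ →L[ℝ] ℝ)) (x := x)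
    h.contDiff_potential h.contDiff_potential μ ν ρ
  simp only [gaugeCurl_zero, zero_apply, smul_zero, add_zero, neg_zero] at hbianchi
  have hdiv := ChargedVector.divergence_gaugeStress (J := (0 : ℝ →L[ℝ] ℝ)) (A := A) (x := x)
    (fun v w => by simp) h.contDiff_faraday faraday_antisymm ν
  simp only [hbianchi, gaugeDiv_zero, h.maxwell] at hdiv
  rw [hdiv]
  simp only [etaInner₂, etaInner, real_inner_smul_right, hJ, RCLike.inner_apply, conj_trivial,
    zero_mul, mul_zero, Finset.sum_const_zero, sub_zero, Finset.mul_sum]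
  exact Finset.sum_congr rfl fun α _ => Finset.sum_congr rfl fun β _ => by ring

theorem divergence_stress (hJ : ∀ v w, ⟪J v, w⟫ = -⟪v, J w⟫) (x : Spacetime) (ν : Fin 4) :
    divergence (fun μ y => stress J m A W y μ ν) x = 0 := by
  have hsplit : divergence (fun μ y => stress J m A W y μ ν) x
      = 2 * (m ^ 2 * divergence (fun μ y => massStress (fun α => W α y) μ ν) x)
        - 2 * divergence (fun μ y => gaugeStress (fun α β => gaugeCurl J A W α β y) μ ν) x
        - divergence (fun μ y => gaugeStress (fun α β => faraday A α β y) μ ν) x := by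
    have hP (μ : Fin 4) := contDiff_massStress h.contDiff_field μ ν
    have hG (μ : Fin 4) := contDiff_gaugeStress h.contDiff_curl μ ν
    have hF (μ : Fin 4) := contDiff_gaugeStress h.contDiff_faraday μ ν
    simp only [stress]
    rw [divergence_sub (fun μ => (contDiff_const.mul (hP μ)).sub (contDiff_const.mul (hG μ))) hF,
      divergence_sub (fun μ => contDiff_const.mul (hP μ)) (fun μ => contDiff_const.mul (hG μ)),
      divergence_const_mul _ hP, divergence_const_mul _ hG, mul_assoc]
  rw [hsplit, h.divergence_massStress hJ, h.divergence_gaugeStress_curl hJ,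
    h.divergence_gaugeStress_faraday hJ]
  ring

theorem divergence_virialCurrent (hJ : ∀ v w, ⟪J v, w⟫ = -⟪v, J w⟫) (x : Spacetime) :
    divergence (virialCurrent J A W) x
      = (1 / 2) * (∑ i : Fin 3, ∑ j : Fin 3, ‖gaugeCurl J A W i.succ j.succ x‖ ^ 2)
        - (∑ i : Fin 3, ‖gaugeCurl J A W 0 i.succ x‖ ^ 2)
        - m ^ 2 * (‖W 0 x‖ ^ 2 - ∑ i : Fin 3, ‖W i.succ x‖ ^ 2) := by
  have hanti (μ ν : Fin 4) : gaugeCurl J A W μ ν x = -gaugeCurl J A W ν μ x :=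
    congrFun (gaugeCurl_antisymm W μ ν) x
  have hproca : etaInner (fun ρ => gaugeDiv J A (fun μ => gaugeCurl J A W μ ρ) x)
      (fun ρ => W ρ x) = -(m ^ 2 * etaInner (fun ρ => W ρ x) (fun ρ => W ρ x)) := by
    simp only [h.proca, etaInner, inner_neg_left, real_inner_smul_left, Finset.mul_sum,
      mul_left_comm, mul_neg, Finset.sum_neg_distrib]
  have hcurl : etaInner₂ (fun μ ρ => gaugeCurl J A W μ ρ x) (fun μ ρ => gaugeCurl J A W μ ρ x)
      = 2 * etaInner₂ (fun μ ρ => gaugeCurl J A W μ ρ x)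
          (fun μ ρ => gaugeDeriv J A μ (W ρ) x) :=
    etaInner₂_sub_swap_right hanti fun μ ρ => gaugeDeriv J A μ (W ρ) x
  rw [etaInner₂_self hanti] at hcurl
  refine (divergence_etaInner (A := A) hJ h.contDiff_curl h.contDiff_field).trans ?_
  rw [hproca, etaInner_self]
  linarith

theorem divergence_dilationCurrent (hJ : ∀ v w, ⟪J v, w⟫ = -⟪v, J w⟫) (x : Spacetime) :
    divergence (dilationCurrent J m A W) x
      = 2 * m ^ 2 * ‖W 0 x‖ ^ 2
        + (∑ i : Fin 3, ∑ j : Fin 3, ‖gaugeCurl J A W i.succ j.succ x‖ ^ 2)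
        + (1 / 2) * (∑ i : Fin 3, ‖faraday A 0 i.succ x‖ ^ 2)
        + (1 / 4) * ∑ i : Fin 3, ∑ j : Fin 3, ‖faraday A i.succ j.succ x‖ ^ 2 := by
  have hradial : divergence (radialCurrent (stress J m A W)) x
      = -∑ k : Fin 3, stress J m A W x k.succ k.succ := by
    simp only [divergence_radialCurrent h.contDiff_stress, h.divergence_stress hJ, mul_zero,
      zero_sub, Finset.sum_neg_distrib]
  have hsplit : divergence (dilationCurrent J m A W) x
      = divergence (virialCurrent J A W) x - divergence (radialCurrent (stress J m A W)) x :=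
    divergence_sub h.contDiff_virialCurrent (contDiff_radialCurrent h.contDiff_stress) x
  rw [hsplit, hradial, h.divergence_virialCurrent hJ, sum_stress_self]
  ring

end IsProcaMaxwell

end ProcaMaxwell

open MeasureTheory

section Slab

/-- The slab `0 ≤ t ≤ T` of space-time. -/
def slab (T : ℝ) : Set Spacetime := {x | 0 ≤ x 0 ∧ x 0 ≤ T}

/-- The spatial position of an event. -/
def spatial : Spacetime →L[ℝ] (Fin 3 → ℝ) :=
  ContinuousLinearMap.pi fun k => ContinuousLinearMap.proj k.succ

theorem spatial_apply (y : Spacetime) (k : Fin 3) : spatial y k = y k.succ := rfl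

theorem event_spatial (y : Spacetime) : event (y 0) (spatial y) = y :=
  Matrix.cons_head_tail y

theorem contDiff_event (t : ℝ) : ContDiff ℝ ∞ (event t) :=
  contDiff_pi.2 fun μ => Fin.cases contDiff_const (fun k => contDiff_apply ℝ ℝ k) μ

theorem measurableSet_slab (T : ℝ) : MeasurableSet (slab T) :=
  (measurableSet_le measurable_const (measurable_pi_apply 0)).inter
    (measurableSet_le (measurable_pi_apply 0) measurable_const)

theorem mem_Icc_event_iff {T B : ℝ} (hB : 0 ≤ B) {y : Spacetime} :
    y ∈ Set.Icc (event 0 fun _ => -B) (event T fun _ => B) ↔ y ∈ slab T ∧ ‖spatial y‖ ≤ B := by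
  simp only [Set.mem_Icc, Pi.le_def, Fin.forall_fin_succ (n := 3), pi_norm_le_iff_of_nonneg hB,
    Real.norm_eq_abs, abs_le, forall_and, slab, Set.mem_ofPred_eq]
  exact and_and_and_comm

theorem contDiff_divergence {j : Fin 4 → Spacetime → ℝ} (hj : ∀ μ, ContDiff ℝ ∞ (j μ)) :
    ContDiff ℝ ∞ (divergence j) :=
  ContDiff.sum fun μ _ => (contDiff_partialDeriv (hj μ) μ).const_smul (eta μ)

theorem integral_box_divergence {j : Fin 4 → Spacetime → ℝ} (hj : ∀ μ, ContDiff ℝ ∞ (j μ))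
    {T B : ℝ} (hT : 0 ≤ T) (hB : 0 ≤ B) (hsupp : ∀ μ y, B ≤ ‖spatial y‖ → j μ y = 0) :
    ∫ y in Set.Icc (event 0 fun _ => -B) (event T fun _ => B), divergence j y
      = (∫ x, j 0 (event T x)) - ∫ x, j 0 (event 0 x) := by
  have hle : event 0 (fun _ => -B) ≤ event T fun _ => B := by
    simpa [Pi.le_def, Fin.forall_fin_succ (n := 3), event] using ⟨hT, by linarith⟩
  have hbox := integral_divergence_of_hasFDerivAt_off_countable' (n := 3) _ _ hle
    (fun μ y => eta μ • j μ y) (fun μ y => eta μ • fderiv ℝ (j μ) y) ∅ Set.countable_empty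
    (fun μ => ((hj μ).const_smul (eta μ)).continuous.continuousOn)
    (fun y _ μ => (differentiableAt_of_smooth (hj μ)).hasFDerivAt.fun_const_smul (eta μ))
    ((contDiff_divergence hj).continuous.continuousOn.integrableOn_compact isCompact_Icc)
  have hwall (k : Fin 3) (c : ℝ) (hc : |c| = B) (x : Fin 3 → ℝ) :
      j k.succ (Fin.insertNth k.succ c x) = 0 := by
    refine hsupp _ _ (le_trans ?_ (norm_le_pi_norm _ k))
    simp [spatial_apply, hc]
  have hface (t : ℝ) : ∫ x in Set.Icc (fun _ : Fin 3 => -B) (fun _ => B), j 0 (event t x)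
      = ∫ x, j 0 (event t x) := by
    refine setIntegral_eq_integral_of_forall_compl_eq_zero fun x hx => hsupp 0 _ ?_
    contrapose! hx
    have habs (k : Fin 3) := abs_le.1 ((norm_le_pi_norm x k).trans hx.le)
    exact ⟨fun k => (habs k).1, fun k => (habs k).2⟩
  refine hbox.trans ?_
  rw [Fin.sum_univ_succ, Finset.sum_eq_zero fun k _ => ?_, ← hface, ← hface]
  · simp only [Fin.succAbove_zero, Fin.insertNth_zero', add_zero, eta,
      Matrix.cons_val_zero, one_smul, event]
    rfl
  · have htop : |event T (fun _ => B) k.succ| = B := abs_of_nonneg hB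
    have hbottom : |event 0 (fun _ => -B) k.succ| = B := (abs_neg B).trans (abs_of_nonneg hB)
    simp only [hwall k _ htop, hwall k _ hbottom, smul_zero, integral_zero, sub_self]

theorem integral_slab_divergence {j : Fin 4 → Spacetime → ℝ} (hj : ∀ μ, ContDiff ℝ ∞ (j μ))
    {T B : ℝ} (hT : 0 ≤ T) (hB : 0 ≤ B) (hsupp : ∀ μ y, B ≤ ‖spatial y‖ → j μ y = 0) :
    ∫ y in slab T, divergence j y = (∫ x, j 0 (event T x)) - ∫ x, j 0 (event 0 x) := by
  rw [← integral_box_divergence hj hT hB hsupp]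
  refine setIntegral_eq_of_subset_of_forall_sdiff_eq_zero (measurableSet_slab T)
    (fun y hy => ((mem_Icc_event_iff hB).1 hy).1) fun y hy => ?_
  have hfar : B < ‖spatial y‖ := by
    by_contra! hnear
    exact hy.2 ((mem_Icc_event_iff hB).2 ⟨hy.1, hnear⟩)
  have hlocal (μ : Fin 4) : j μ =ᶠ[𝓝 y] fun _ => 0 := by
    filter_upwards [(isOpen_lt continuous_const spatial.continuous.norm).mem_nhds hfar] with z hz
    exact hsupp μ z (le_of_lt hz)
  simp [divergence, partialDeriv, (hlocal _).fderiv_eq]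

end Slab

section Cutoff

/-- A smooth rotation invariant function which is `1` near the origin of space and `0` at distances
larger than `2`. -/
def cutoff (z : Fin 3 → ℝ) : ℝ := Real.smoothTransition (2 - z ⬝ᵥ z)

theorem contDiff_cutoff : ContDiff ℝ ∞ cutoff :=
  Real.smoothTransition.contDiff.comp (contDiff_const.sub
    (ContDiff.sum fun k _ => (contDiff_apply ℝ ℝ k).mul (contDiff_apply ℝ ℝ k)))

theorem abs_cutoff_le_one (z : Fin 3 → ℝ) : |cutoff z| ≤ 1 :=
  abs_le.2 ⟨by linarith [Real.smoothTransition.nonneg (2 - z ⬝ᵥ z), cutoff.eq_1 z],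
    Real.smoothTransition.le_one _⟩

theorem cutoff_eq_zero {z : Fin 3 → ℝ} (hz : 2 ≤ ‖z‖) : cutoff z = 0 := by
  obtain ⟨k, hk⟩ : ∃ k, 2 ≤ |z k| := by
    by_contra! hcon
    exact hz.not_gt ((pi_norm_lt_iff two_pos).2 hcon)
  have hsum : z k * z k ≤ z ⬝ᵥ z :=
    Finset.single_le_sum (f := fun i => z i * z i) (fun i _ => mul_self_nonneg _)
      (Finset.mem_univ k)
  refine Real.smoothTransition.zero_of_nonpos ?_
  nlinarith [abs_mul_abs_self (z k)]

theorem cutoff_eventuallyEq_one : cutoff =ᶠ[𝓝 0] fun _ => 1 := by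
  have hopen : IsOpen {z : Fin 3 → ℝ | z ⬝ᵥ z < 1} :=
    isOpen_lt (continuous_id.dotProduct continuous_id) continuous_const
  filter_upwards [hopen.mem_nhds (by simp)] with z hz
  exact Real.smoothTransition.one_of_one_le (by linarith [show z ⬝ᵥ z < 1 from hz])

theorem cutoff_mulVec {R : Matrix (Fin 3) (Fin 3) ℝ} (hR : R * R.transpose = 1)
    (z : Fin 3 → ℝ) : cutoff (R.mulVec z) = cutoff z := by
  rw [cutoff, cutoff, Matrix.dotProduct_mulVec, Matrix.vecMul_mulVec, mul_eq_one_comm.1 hR,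
    Matrix.vecMul_one]

theorem exists_bound_fderiv_cutoff : ∃ K, ∀ z, (1 + ‖z‖) * ‖fderiv ℝ cutoff z‖ ≤ K := by
  have hcont : Continuous fun z => (1 + ‖z‖) * ‖fderiv ℝ cutoff z‖ :=
    (continuous_const.add continuous_norm).mul
      (contDiff_cutoff.continuous_fderiv (by simp)).norm
  have hsupp : HasCompactSupport cutoff :=
    HasCompactSupport.intro (isCompact_closedBall 0 2) fun z hz =>
      cutoff_eq_zero (le_of_lt (by simpa using hz))
  obtain ⟨K, hK⟩ := hcont.bounded_above_of_compact_support ((hsupp.fderiv ℝ).norm.mul_left)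
  exact ⟨K, fun z => (le_abs_self _).trans (hK z)⟩

theorem divergence_cutoff_mul {j : Fin 4 → Spacetime → ℝ} (hj : ∀ μ, ContDiff ℝ ∞ (j μ)) (r : ℝ)
    (y : Spacetime) :
    divergence (fun μ z => cutoff (r • spatial z) * j μ z) y
      = cutoff (r • spatial y) * divergence j y
        - r * fderiv ℝ cutoff (r • spatial y) (fun k => j k.succ y) := by
  have hcut : HasFDerivAt (fun z : Spacetime => cutoff (r • spatial z))
      ((fderiv ℝ cutoff (r • spatial y)).comp (r • spatial)) y :=
    (contDiff_cutoff.differentiable (by simp) _).hasFDerivAt.comp (g := cutoff) y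
      (spatial.hasFDerivAt.fun_const_smul r)
  have hterm (μ : Fin 4) : partialDeriv μ (fun z => cutoff (r • spatial z) * j μ z) y
      = cutoff (r • spatial y) * partialDeriv μ (j μ) y
        + j μ y * (r * fderiv ℝ cutoff (r • spatial y) (spatial (Pi.single μ 1))) := by
    rw [partialDeriv, (hcut.fun_mul (differentiableAt_of_smooth (hj μ)).hasFDerivAt).fderiv]
    simp [partialDeriv]
  have htime : spatial (Pi.single 0 1) = 0 := by
    ext k
    simp [spatial_apply]
  have hspace (k : Fin 3) : spatial (Pi.single k.succ 1) = Pi.single k 1 := by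
    ext i
    simp [spatial_apply, Pi.single_apply]
  have hsum : fderiv ℝ cutoff (r • spatial y) (fun k => j k.succ y)
      = ∑ k : Fin 3, j k.succ y * fderiv ℝ cutoff (r • spatial y) (Pi.single k 1) := by
    rw [pi_eq_sum_univ' (fun k : Fin 3 => j k.succ y), map_sum]
    simp
  rw [hsum]
  simp only [divergence, hterm, Fin.sum_univ_succ (n := 3), htime, hspace, smul_eq_mul, map_zero,
    Fin.sum_univ_three]
  simp only [eta, Matrix.cons_val_zero, Matrix.cons_val_succ, Matrix.cons_val]
  ring

end Cutoff

section Virial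

theorem integral_comp_mulVec {R : Matrix (Fin 3) (Fin 3) ℝ} (hR : R * R.transpose = 1)
    {f : (Fin 3 → ℝ) → ℝ} (hf : Continuous f) : ∫ x, f (R.mulVec x) = ∫ x, f x := by
  have hdet : |R.det| = 1 := by
    have hsq := congrArg Matrix.det hR
    rw [Matrix.det_mul, Matrix.det_transpose, Matrix.det_one] at hsq
    exact abs_eq_abs.2 (mul_self_eq_one_iff.1 hsq) |>.trans abs_one
  have hmap : (volume : Measure (Fin 3 → ℝ)).map (Matrix.toLin' R) = volume := by
    simpa [abs_inv, hdet] using Real.map_matrix_volume_pi_eq_smul_volume_pi (M := R)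
      (abs_ne_zero.1 (hdet.trans_ne one_ne_zero))
  have hcont : Continuous (Matrix.toLin' R) := LinearMap.continuous_of_finiteDimensional _
  conv_rhs => rw [← hmap, integral_map hcont.aemeasurable hf.aestronglyMeasurable]
  rfl

variable {j : Fin 4 → Spacetime → ℝ} (hj : ∀ μ, ContDiff ℝ ∞ (j μ))

theorem contDiff_cutoff_mul {f : Spacetime → ℝ} (hf : ContDiff ℝ ∞ f) (r : ℝ) :
    ContDiff ℝ ∞ fun y => cutoff (r • spatial y) * f y :=
  (contDiff_cutoff.comp (spatial.contDiff.const_smul r)).mul hf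

include hj

theorem integral_divergence_cutoff_mul {T : ℝ} (hT : 0 ≤ T)
    {R : Matrix (Fin 3) (Fin 3) ℝ} (hR : R * R.transpose = 1)
    (hper : ∀ x, j 0 (event T (R.mulVec x)) = j 0 (event 0 x)) {r : ℝ} (hr : 0 < r) :
    ∫ y in slab T, divergence (fun μ z => cutoff (r • spatial z) * j μ z) y = 0 := by
  have hfar (μ : Fin 4) (y : Spacetime) (hy : 2 / r ≤ ‖spatial y‖) :
      cutoff (r • spatial y) * j μ y = 0 := by
    rw [cutoff_eq_zero, zero_mul]
    rwa [norm_smul, Real.norm_of_nonneg hr.le, ← div_le_iff₀' hr]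
  have hcont : Continuous fun x => cutoff (r • spatial (event T x)) * j 0 (event T x) :=
    (contDiff_cutoff_mul (hj 0) r).continuous.comp (contDiff_event T).continuous
  rw [integral_slab_divergence (fun μ => contDiff_cutoff_mul (hj μ) r) hT
    (div_nonneg zero_le_two hr.le) hfar, sub_eq_zero, ← integral_comp_mulVec hR hcont]
  refine integral_congr_ae (.of_forall fun x => ?_)
  have hspatial (t : ℝ) (z : Fin 3 → ℝ) : spatial (event t z) = z := rfl
  simp only [hper, hspatial, ← Matrix.mulVec_smul, cutoff_mulVec hR]

theorem abs_divergence_cutoff_mul_le {K : ℝ} (hK : ∀ z, (1 + ‖z‖) * ‖fderiv ℝ cutoff z‖ ≤ K)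
    {ε : Spacetime → ℝ} (hbound : ∀ y, ‖fun k : Fin 3 => j k.succ y‖ ≤ (1 + ‖spatial y‖) * ε y)
    {r : ℝ} (hr : 0 < r) (hr1 : r ≤ 1) (y : Spacetime) :
    |divergence (fun μ z => cutoff (r • spatial z) * j μ z) y|
      ≤ |divergence j y| + K * ε y := by
  have hpos : 0 < 1 + ‖spatial y‖ := by positivity
  have hε : 0 ≤ ε y := nonneg_of_mul_nonneg_right ((norm_nonneg _).trans (hbound y)) hpos
  have hscale : r * (1 + ‖spatial y‖) ≤ 1 + ‖r • spatial y‖ := by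
    rw [norm_smul, Real.norm_of_nonneg hr.le]
    linarith
  have hmain : |cutoff (r • spatial y) * divergence j y| ≤ |divergence j y| := by
    rw [abs_mul]
    exact mul_le_of_le_one_left (abs_nonneg _) (abs_cutoff_le_one _)
  have hwall : |r * fderiv ℝ cutoff (r • spatial y) (fun k => j k.succ y)| ≤ K * ε y :=
    calc |r * fderiv ℝ cutoff (r • spatial y) (fun k => j k.succ y)|
        ≤ r * (‖fderiv ℝ cutoff (r • spatial y)‖ * ((1 + ‖spatial y‖) * ε y)) := by
          rw [abs_mul, abs_of_pos hr]
          gcongr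
          exact (fderiv ℝ cutoff (r • spatial y)).le_opNorm_of_le (hbound y)
      _ = r * (1 + ‖spatial y‖) * ‖fderiv ℝ cutoff (r • spatial y)‖ * ε y := by ring
      _ ≤ (1 + ‖r • spatial y‖) * ‖fderiv ℝ cutoff (r • spatial y)‖ * ε y := by gcongr
      _ ≤ K * ε y := by
          gcongr
          exact hK _
  rw [divergence_cutoff_mul hj]
  exact (abs_sub _ _).trans (add_le_add hmain hwall)

theorem tendsto_divergence_cutoff_mul (y : Spacetime) :
    Filter.Tendsto (fun r : ℝ => divergence (fun μ z => cutoff (r • spatial z) * j μ z) y)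
      (𝓝 0) (𝓝 (divergence j y)) := by
  have hscale : Filter.Tendsto (fun r : ℝ => r • spatial y) (𝓝 0) (𝓝 0) := by
    simpa using (Filter.tendsto_id (x := 𝓝 (0 : ℝ))).smul_const (spatial y)
  have hlocal : ∀ᶠ z in 𝓝 0, cutoff z = 1 ∧ fderiv ℝ cutoff z = 0 :=
    (cutoff_eventuallyEq_one.and cutoff_eventuallyEq_one.fderiv).mono fun z hz =>
      ⟨hz.1, hz.2.trans (by simp)⟩
  refine tendsto_const_nhds.congr' ((hscale.eventually hlocal).mono fun r hr => ?_)
  simp [divergence_cutoff_mul hj, hr.1, hr.2]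

theorem integral_divergence_eq_zero {T : ℝ} (hT : 0 ≤ T)
    {R : Matrix (Fin 3) (Fin 3) ℝ} (hR : R * R.transpose = 1)
    (hper : ∀ x, j 0 (event T (R.mulVec x)) = j 0 (event 0 x))
    {ε : Spacetime → ℝ} (hε : IntegrableOn ε (slab T))
    (hbound : ∀ y, ‖fun k : Fin 3 => j k.succ y‖ ≤ (1 + ‖spatial y‖) * ε y)
    (hdiv : IntegrableOn (divergence j) (slab T)) :
    ∫ y in slab T, divergence j y = 0 := by
  obtain ⟨K, hK⟩ := exists_bound_fderiv_cutoff
  obtain ⟨r, -, hr, hr0⟩ := exists_seq_strictAnti_tendsto' (zero_lt_one (α := ℝ))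
  have hlim : Filter.Tendsto
      (fun n => ∫ y in slab T, divergence (fun μ z => cutoff (r n • spatial z) * j μ z) y)
      Filter.atTop (𝓝 (∫ y in slab T, divergence j y)) := by
    refine tendsto_integral_of_dominated_convergence (fun y => |divergence j y| + K * ε y)
      (fun n => ?_) (hdiv.abs.add (hε.const_mul K)) (fun n => .of_forall fun y => ?_)
      (.of_forall fun y => (tendsto_divergence_cutoff_mul hj y).comp hr0)
    · exact (contDiff_divergence fun μ =>
        contDiff_cutoff_mul (hj μ) _).continuous.aestronglyMeasurable
    · exact abs_divergence_cutoff_mul_le hj hK hbound (hr n).1 (hr n).2.le y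
  simp only [integral_divergence_cutoff_mul hj hT hR hper (hr _).1] at hlim
  exact tendsto_nhds_unique hlim tendsto_const_nhds

end Virial

section Pull

variable {V : Type*} [AddCommGroup V] [Module ℝ V] {M : Matrix (Fin 4) (Fin 4) ℝ}

/-- The action `a_μ ↦ M^ν_μ a_ν` of a matrix on covectors. -/
def pull (M : Matrix (Fin 4) (Fin 4) ℝ) (a : Fin 4 → V) (μ : Fin 4) : V :=
  ∑ ν, M ν μ • a ν

/-- The action `S_{μν} ↦ M^α_μ M^β_ν S_{αβ}` of a matrix on tensors with two lower indices. -/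
def pull₂ (M : Matrix (Fin 4) (Fin 4) ℝ) (S : Fin 4 → Fin 4 → V) (μ ν : Fin 4) : V :=
  pull M (fun α => pull M (S α) ν) μ

/-- Lorentz matrices: those which preserve the Minkowski metric. -/
def IsLorentz (M : Matrix (Fin 4) (Fin 4) ℝ) : Prop :=
  M * Matrix.diagonal eta * M.transpose = Matrix.diagonal eta

theorem metric_zero_zero : metric 0 0 = 1 := by simp [metric, eta]

theorem metric_zero_succ (j : Fin 3) : metric 0 j.succ = 0 := if_neg (Fin.succ_ne_zero j).symm

theorem metric_succ_zero (i : Fin 3) : metric i.succ 0 = 0 := if_neg (Fin.succ_ne_zero i)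

theorem metric_succ_succ (i j : Fin 3) : metric i.succ j.succ = -if i = j then 1 else 0 := by
  fin_cases i <;> fin_cases j <;> simp [metric, eta]

theorem isLorentz_iff : IsLorentz M ↔ ∀ μ ν, M μ 0 * M ν 0
    - (fun k : Fin 3 => M μ k.succ) ⬝ᵥ (fun k : Fin 3 => M ν k.succ) = metric μ ν := by
  rw [IsLorentz, ← Matrix.ext_iff]
  refine forall₂_congr fun μ ν => ?_
  have hzero : eta 0 = 1 := rfl
  have heta (k : Fin 3) : eta k.succ = -1 := by fin_cases k <;> simp [eta]
  have hsum : (M * Matrix.diagonal eta * M.transpose) μ ν = M μ 0 * M ν 0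
      - (fun k : Fin 3 => M μ k.succ) ⬝ᵥ (fun k : Fin 3 => M ν k.succ) := by
    rw [Matrix.mul_apply]
    simp only [Matrix.mul_diagonal, Matrix.transpose_apply]
    simp [Fin.sum_univ_succ (n := 3), heta, hzero, dotProduct, sub_eq_add_neg]
  rw [hsum, Matrix.diagonal_apply, metric]

theorem pull_mul (M N : Matrix (Fin 4) (Fin 4) ℝ) (a : Fin 4 → V) :
    pull (M * N) a = pull N (pull M a) := by
  funext μ
  simp only [pull, Matrix.mul_apply, Finset.sum_smul, Finset.smul_sum, smul_smul]
  rw [Finset.sum_comm]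
  simp only [mul_comm]

theorem pull₂_swap (S : Fin 4 → Fin 4 → V) (μ ν : Fin 4) :
    pull₂ M (fun α β => S β α) μ ν = pull₂ M S ν μ := by
  simp only [pull₂, pull, Finset.smul_sum]
  rw [Finset.sum_comm]
  exact Finset.sum_congr rfl fun α _ => Finset.sum_congr rfl fun β _ => smul_comm _ _ _

theorem pull₂_sub (S R : Fin 4 → Fin 4 → V) (μ ν : Fin 4) :
    pull₂ M (fun α β => S α β - R α β) μ ν = pull₂ M S μ ν - pull₂ M R μ ν := by
  simp only [pull₂, pull, smul_sub, Finset.sum_sub_distrib]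

theorem pull₂_mul_const (S : Fin 4 → Fin 4 → ℝ) (c : ℝ) (μ ν : Fin 4) :
    pull₂ M (fun α β => S α β * c) μ ν = pull₂ M S μ ν * c := by
  simp only [pull₂, pull, smul_eq_mul, Finset.sum_mul, mul_assoc]

/-- The block matrix `1 ⊕ R` by which a matrix acts on the spatial coordinates. -/
def spatialBlock (R : Matrix (Fin 3) (Fin 3) ℝ) : Matrix (Fin 4) (Fin 4) ℝ :=
  Matrix.of (Matrix.vecCons (Matrix.vecCons 1 0) fun i => Matrix.vecCons 0 (R i))

theorem spatialBlock_mulVec_event (R : Matrix (Fin 3) (Fin 3) ℝ) (t : ℝ) (x : Fin 3 → ℝ) :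
    (spatialBlock R).mulVec (event t x) = event t (R.mulVec x) := by
  funext μ
  refine Fin.cases ?_ (fun i => ?_) μ <;>
    simp [spatialBlock, event, Matrix.mulVec, dotProduct, Fin.sum_univ_succ]

theorem pull_spatialBlock_zero (R : Matrix (Fin 3) (Fin 3) ℝ) (a : Fin 4 → V) :
    pull (spatialBlock R) a 0 = a 0 := by
  simp [pull, spatialBlock, Fin.sum_univ_succ]

theorem pull_spatialBlock_succ (R : Matrix (Fin 3) (Fin 3) ℝ) (a : Fin 4 → V) (i : Fin 3) :
    pull (spatialBlock R) a i.succ = ∑ j : Fin 3, R j i • a j.succ := by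
  simp [pull, spatialBlock, Fin.sum_univ_succ]

namespace IsLorentz

variable (hM : IsLorentz M)
include hM

theorem sum_eta_mul (α β : Fin 4) : ∑ μ, eta μ * (M α μ * M β μ) = metric α β := by
  have h := congrFun₂ hM α β
  rw [Matrix.mul_apply, Matrix.diagonal_apply] at h
  rw [metric, ← h]
  refine Finset.sum_congr rfl fun μ _ => ?_
  rw [Matrix.mul_diagonal, Matrix.transpose_apply]
  ring

theorem mul_eta_mul_transpose_mul_eta :
    M * (Matrix.diagonal eta * M.transpose * Matrix.diagonal eta) = 1 := by
  rw [← Matrix.mul_assoc, ← Matrix.mul_assoc, hM, Matrix.diagonal_mul_diagonal]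
  simp only [eta_mul_self, Matrix.diagonal_one]

theorem transpose : IsLorentz M.transpose := by
  have hη : Matrix.diagonal eta * Matrix.diagonal eta = 1 := by
    simp only [Matrix.diagonal_mul_diagonal, eta_mul_self, Matrix.diagonal_one]
  have hinv := mul_eq_one_comm.1 hM.mul_eta_mul_transpose_mul_eta
  rw [IsLorentz, Matrix.transpose_transpose, ← one_mul (M.transpose * _ * M), ← hη]
  simpa only [Matrix.mul_assoc, mul_one] using congrArg (Matrix.diagonal eta * ·) hinv

theorem exists_mulVec_eq (c x : Spacetime) : ∃ y, M.mulVec y + c = x :=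
  ⟨(Matrix.diagonal eta * M.transpose * Matrix.diagonal eta).mulVec (x - c), by
    rw [Matrix.mulVec_mulVec, hM.mul_eta_mul_transpose_mul_eta, Matrix.one_mulVec, sub_add_cancel]⟩

theorem pull_eq_zero_iff {a : Fin 4 → V} : pull M a = 0 ↔ a = 0 := by
  refine ⟨fun ha => ?_, fun ha => by funext μ; simp [ha, pull]⟩
  have hone : pull 1 a = a := by funext μ; simp [pull, Matrix.one_apply]
  rw [← hone, ← hM.mul_eta_mul_transpose_mul_eta, pull_mul, ha]
  funext μ
  simp [pull]

theorem pull₂_eq_zero_iff {S : Fin 4 → Fin 4 → V} : pull₂ M S = 0 ↔ S = 0 := by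
  have hcol (ν : Fin 4) := hM.pull_eq_zero_iff (a := fun α => pull M (S α) ν)
  have hrow (α : Fin 4) := hM.pull_eq_zero_iff (a := S α)
  simp only [funext_iff, Pi.zero_apply] at hcol hrow ⊢
  simp only [pull₂, ← hrow]
  exact ⟨fun h α ν => (hcol ν).1 (fun μ => h μ ν) α, fun h μ ν => (hcol ν).2 (fun α => h α ν) μ⟩

theorem sum_eta_pull₂ (S : Fin 4 → Fin 4 → V) :
    ∑ μ, eta μ • pull₂ M S μ μ = ∑ μ, eta μ • S μ μ := by
  have hcoef (α β : Fin 4) : ∑ μ, eta μ • M α μ • M β μ • S α β = metric α β • S α β := by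
    simp only [smul_smul, ← Finset.sum_smul, ← hM.sum_eta_mul]
  calc ∑ μ, eta μ • pull₂ M S μ μ
      = ∑ α, ∑ β, ∑ μ, eta μ • M α μ • M β μ • S α β := by
        simp only [pull₂, pull, Finset.smul_sum]
        rw [Finset.sum_comm]
        exact Finset.sum_congr rfl fun α _ => Finset.sum_comm
    _ = ∑ μ, eta μ • S μ μ := by simp [hcoef, metric]

theorem pull₂_metric : pull₂ M metric = metric := by
  funext μ ν
  rw [← hM.transpose.sum_eta_mul]
  simp only [pull₂, pull, metric, smul_eq_mul, mul_ite, mul_zero, Finset.sum_ite_eq,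
    Finset.mem_univ, if_true, Matrix.transpose_apply]
  exact Finset.sum_congr rfl fun α _ => by ring

end IsLorentz

end Pull

section PullInner

variable {V : Type*} [NormedAddCommGroup V] [InnerProductSpace ℝ V]
  {M : Matrix (Fin 4) (Fin 4) ℝ}

theorem inner_pull_pull (a b : Fin 4 → V) (μ ν : Fin 4) :
    ⟪pull M a μ, pull M b ν⟫ = pull₂ M (fun α β => ⟪a α, b β⟫) μ ν := by
  simp only [pull₂, pull, sum_inner, inner_sum, real_inner_smul_left, real_inner_smul_right,
    smul_eq_mul, Finset.mul_sum]
  rw [Finset.sum_comm]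
  exact Finset.sum_congr rfl fun α _ => Finset.sum_congr rfl fun β _ => mul_left_comm _ _ _

theorem etaInner_pull_left (G : Fin 4 → Fin 4 → V) (b : Fin 4 → V) (μ : Fin 4) :
    etaInner (fun σ => pull M (fun α => G α σ) μ) b = pull M (fun α => etaInner (G α) b) μ := by
  simp only [etaInner, pull, sum_inner, real_inner_smul_left, smul_eq_mul, Finset.mul_sum,
    mul_left_comm (eta _)]
  exact Finset.sum_comm

namespace IsLorentz

variable (hM : IsLorentz M)
include hM

theorem etaInner_pull (a b : Fin 4 → V) : etaInner (pull M a) (pull M b) = etaInner a b := by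
  simpa only [etaInner, inner_pull_pull, smul_eq_mul] using hM.sum_eta_pull₂ fun α β => ⟪a α, b β⟫

theorem etaInner_pull₂_pull (G : Fin 4 → Fin 4 → V) (w : Fin 4 → V) (μ : Fin 4) :
    etaInner (pull₂ M G μ) (pull M w) = pull M (fun α => etaInner (G α) w) μ :=
  (etaInner_pull_left (fun α => pull M (G α)) _ μ).trans (by simp only [hM.etaInner_pull])

theorem etaInner_pull₂ (G H : Fin 4 → Fin 4 → V) (μ ν : Fin 4) :
    etaInner (pull₂ M G μ) (pull₂ M H ν) = pull₂ M (fun α β => etaInner (G α) (H β)) μ ν := by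
  have hright (a : Fin 4 → V) :
      etaInner (pull M a) (pull₂ M H ν) = pull M (fun β => etaInner a (H β)) ν := by
    simp only [etaInner_comm _ (pull₂ M H ν), hM.etaInner_pull₂_pull, etaInner_comm a]
  exact (etaInner_pull_left (fun α => pull M (G α)) _ μ).trans (by simp only [hright, pull₂])

theorem etaInner₂_pull₂ (G H : Fin 4 → Fin 4 → V) :
    etaInner₂ (pull₂ M G) (pull₂ M H) = etaInner₂ G H := by
  simpa only [etaInner₂, hM.etaInner_pull₂, smul_eq_mul] using
    hM.sum_eta_pull₂ fun α β => etaInner (G α) (H β)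

theorem massStress_pull (w : Fin 4 → V) : massStress (pull M w) = pull₂ M (massStress w) := by
  funext μ ν
  unfold massStress
  rw [pull₂_sub, pull₂_mul_const, hM.pull₂_metric, inner_pull_pull, hM.etaInner_pull]

theorem gaugeStress_pull₂ (G : Fin 4 → Fin 4 → V) :
    gaugeStress (pull₂ M G) = pull₂ M (gaugeStress G) := by
  funext μ ν
  unfold gaugeStress
  rw [pull₂_sub, pull₂_mul_const, hM.pull₂_metric, hM.etaInner_pull₂, hM.etaInner₂_pull₂]

end IsLorentz

end PullInner

section Pullback

variable {V : Type*} [NormedAddCommGroup V] [InnerProductSpace ℝ V] {J : V →L[ℝ] V} {m : ℝ}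
  {A : Fin 4 → Spacetime → ℝ} {W : Fin 4 → Spacetime → V} {M : Matrix (Fin 4) (Fin 4) ℝ}
  {c : Spacetime}

/-- The pullback of a covector field along the affine map `y ↦ M y + c`. -/
def pullback (M : Matrix (Fin 4) (Fin 4) ℝ) (c : Spacetime) (W : Fin 4 → Spacetime → V)
    (μ : Fin 4) (y : Spacetime) : V :=
  pull M (fun ν => W ν (M.mulVec y + c)) μ

theorem pullback_pullback (M N : Matrix (Fin 4) (Fin 4) ℝ) (c d : Spacetime)
    (W : Fin 4 → Spacetime → V) :
    pullback N d (pullback M c W) = pullback (M * N) (M.mulVec d + c) W := by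
  funext μ y
  simp only [pullback, pull_mul, Matrix.mulVec_add, Matrix.mulVec_mulVec, add_assoc]

theorem contDiff_comp_affine {f : Spacetime → V} (hf : ContDiff ℝ ∞ f) :
    ContDiff ℝ ∞ fun y => f (M.mulVec y + c) :=
  hf.comp ((LinearMap.toContinuousLinearMap M.mulVecLin).contDiff.add contDiff_const)

theorem contDiff_pullback (hW : ∀ μ, ContDiff ℝ ∞ (W μ)) (μ : Fin 4) :
    ContDiff ℝ ∞ (pullback M c W μ) :=
  ContDiff.sum (s := Finset.univ) (f := fun ν y => M ν μ • W ν (M.mulVec y + c)) fun ν _ =>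
    (contDiff_comp_affine (hW ν)).const_smul (M ν μ)

theorem gaugeDeriv_pullback (hW : ∀ μ, ContDiff ℝ ∞ (W μ)) (μ ν : Fin 4) (y : Spacetime) :
    gaugeDeriv J (pullback M c A) μ (pullback M c W ν) y
      = pull₂ M (fun α β => gaugeDeriv J A α (W β) (M.mulVec y + c)) μ ν := by
  have hdiff (β : Fin 4) : DifferentiableAt ℝ (fun z => W β (M.mulVec z + c)) y :=
    differentiableAt_of_smooth (contDiff_comp_affine (hW β))
  have hscalar (β : Fin 4) :
      gaugeDeriv J (pullback M c A) μ (fun z => W β (M.mulVec z + c)) y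
        = pull M (fun α => gaugeDeriv J A α (W β) (M.mulVec y + c)) μ := by
    simp only [gaugeDeriv, partialDeriv_comp_affine (hW β), pullback, pull, smul_sub,
      Finset.sum_sub_distrib, Finset.sum_smul, smul_eq_mul, mul_smul]
  calc gaugeDeriv J (pullback M c A) μ (pullback M c W ν) y
      = ∑ β, M β ν • gaugeDeriv J (pullback M c A) μ (fun z => W β (M.mulVec z + c)) y := by
        simp only [← gaugeDeriv_const_smul _ (hdiff _)]
        exact gaugeDeriv_sum (F := fun β z => M β ν • W β (M.mulVec z + c)) Finset.univ
          (fun β _ => (hdiff β).const_smul (M β ν)) μ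
    _ = pull₂ M (fun β α => gaugeDeriv J A α (W β) (M.mulVec y + c)) ν μ := by
        simp only [hscalar, pull₂]
        rfl
    _ = _ := pull₂_swap (fun α β => gaugeDeriv J A α (W β) (M.mulVec y + c)) ν μ

theorem gaugeCurl_pullback (hW : ∀ μ, ContDiff ℝ ∞ (W μ)) (μ ν : Fin 4) (y : Spacetime) :
    gaugeCurl J (pullback M c A) (pullback M c W) μ ν y
      = pull₂ M (fun α β => gaugeCurl J A W α β (M.mulVec y + c)) μ ν := by
  simp only [gaugeCurl, gaugeDeriv_pullback hW, pull₂_sub]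
  congr 1
  exact (pull₂_swap _ _ _).symm

theorem faraday_pullback (hA : ∀ μ, ContDiff ℝ ∞ (A μ)) (μ ν : Fin 4) (y : Spacetime) :
    faraday (pullback M c A) μ ν y = pull₂ M (fun α β => faraday A α β (M.mulVec y + c)) μ ν := by
  simpa only [gaugeCurl_zero] using gaugeCurl_pullback (J := 0) (A := A) hA μ ν y

namespace IsLorentz

variable (hM : IsLorentz M)
include hM

theorem gaugeDiv_pullback (hW : ∀ μ, ContDiff ℝ ∞ (W μ)) (y : Spacetime) :
    gaugeDiv J (pullback M c A) (pullback M c W) y = gaugeDiv J A W (M.mulVec y + c) := by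
  simp only [gaugeDiv, gaugeDeriv_pullback hW]
  exact hM.sum_eta_pull₂ _

theorem gaugeDiv_pull₂ {G : Fin 4 → Fin 4 → Spacetime → V} (hG : ∀ μ ν, ContDiff ℝ ∞ (G μ ν))
    (ν : Fin 4) (y : Spacetime) :
    gaugeDiv J (pullback M c A)
        (fun μ z => pull₂ M (fun α β => G α β (M.mulVec z + c)) μ ν) y
      = pull M (fun β => gaugeDiv J A (fun α => G α β) (M.mulVec y + c)) ν := by
  have hdiff (μ β : Fin 4) : DifferentiableAt ℝ (pullback M c (fun α => G α β) μ) y :=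
    differentiableAt_of_smooth (contDiff_pullback (fun α => hG α β) μ)
  have hterm (μ : Fin 4) : gaugeDeriv J (pullback M c A) μ
      (fun z => pull₂ M (fun α β => G α β (M.mulVec z + c)) μ ν) y
        = pull M (fun β => gaugeDeriv J (pullback M c A) μ
            (pullback M c (fun α => G α β) μ) y) ν := by
    simp only [← pull₂_swap (fun α β => G α β _) ν, pull, ← gaugeDeriv_const_smul _ (hdiff _ _)]
    exact gaugeDeriv_sum (F := fun β z => M β ν • pullback M c (fun α => G α β) μ z) Finset.univ
      (fun β _ => (hdiff μ β).const_smul (M β ν)) μ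
  have hdiv (β : Fin 4) := hM.gaugeDiv_pullback (J := J) (A := A) (c := c) (fun α => hG α β) y
  simp only [← hdiv]
  simp only [gaugeDiv, hterm, pull, Finset.smul_sum]
  rw [Finset.sum_comm]
  exact Finset.sum_congr rfl fun β _ => Finset.sum_congr rfl fun μ _ => smul_comm _ _ _

theorem isProcaMaxwell_pullback (h : IsProcaMaxwell J m A W) :
    IsProcaMaxwell J m (pullback M c A) (pullback M c W) where
  contDiff_potential := contDiff_pullback h.contDiff_potential
  contDiff_field := contDiff_pullback h.contDiff_field
  proca ν y := by
    have hcurl (μ : Fin 4) : gaugeCurl J (pullback M c A) (pullback M c W) μ ν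
        = fun z => pull₂ M (fun α β => gaugeCurl J A W α β (M.mulVec z + c)) μ ν :=
      funext (gaugeCurl_pullback h.contDiff_field μ ν)
    simp only [hcurl, hM.gaugeDiv_pull₂ h.contDiff_curl, h.proca, pullback, pull, smul_neg,
      Finset.sum_neg_distrib, Finset.smul_sum]
    exact congrArg _ (Finset.sum_congr rfl fun β _ => smul_comm _ _ _)
  maxwell ρ y := by
    have hcurl (μ : Fin 4) : faraday (pullback M c A) μ ρ
        = fun z => pull₂ M (fun α β => faraday A α β (M.mulVec z + c)) μ ρ :=
      funext (faraday_pullback h.contDiff_potential μ ρ)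
    have hdiv := hM.gaugeDiv_pull₂ (J := 0) (A := A) (c := c) h.contDiff_faraday ρ y
    simp only [gaugeDiv_zero, h.maxwell] at hdiv
    have hcurrent := hM.etaInner_pull₂_pull
      (fun α β => J (gaugeCurl J A W α β (M.mulVec y + c))) (fun β => W β (M.mulVec y + c)) ρ
    have hgen (σ : Fin 4) : J (gaugeCurl J (pullback M c A) (pullback M c W) ρ σ y)
        = pull₂ M (fun α β => J (gaugeCurl J A W α β (M.mulVec y + c))) ρ σ := by
      simp only [gaugeCurl_pullback h.contDiff_field, pull₂, pull, map_sum, map_smul]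
    simp only [hcurl, hdiv, hgen]
    refine Eq.trans ?_ (congrArg (2 * ·) hcurrent).symm
    simp only [pull, smul_eq_mul, Finset.mul_sum, mul_left_comm]

theorem virialCurrent_pullback (hW : ∀ μ, ContDiff ℝ ∞ (W μ)) (μ : Fin 4) (y : Spacetime) :
    virialCurrent J (pullback M c A) (pullback M c W) μ y
      = pullback M c (virialCurrent J A W) μ y := by
  simp only [virialCurrent, gaugeCurl_pullback hW]
  exact hM.etaInner_pull₂_pull _ _ μ

theorem stress_pullback (h : IsProcaMaxwell J m A W) (y : Spacetime) :
    stress J m (pullback M c A) (pullback M c W) y = pull₂ M (stress J m A W (M.mulVec y + c)) := by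
  funext μ ν
  have hcurl : (fun α β => gaugeCurl J (pullback M c A) (pullback M c W) α β y)
      = pull₂ M fun α β => gaugeCurl J A W α β (M.mulVec y + c) :=
    funext₂ fun α β => gaugeCurl_pullback h.contDiff_field α β y
  have hfaraday : (fun α β => faraday (pullback M c A) α β y)
      = pull₂ M fun α β => faraday A α β (M.mulVec y + c) :=
    funext₂ fun α β => faraday_pullback h.contDiff_potential α β y
  simp only [stress, hcurl, hfaraday, pullback, hM.massStress_pull, hM.gaugeStress_pull₂]
  simp only [pull₂, pull, stress, smul_eq_mul, mul_sub, Finset.mul_sum, Finset.sum_sub_distrib,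
    mul_left_comm]

end IsLorentz

end Pullback

section SpatialBlock

variable {V : Type*} [NormedAddCommGroup V] [InnerProductSpace ℝ V] {J : V →L[ℝ] V} {m : ℝ}
  {A : Fin 4 → Spacetime → ℝ} {W : Fin 4 → Spacetime → V} {R : Matrix (Fin 3) (Fin 3) ℝ} {T : ℝ}

theorem isLorentz_spatialBlock (hR : R * R.transpose = 1) : IsLorentz (spatialBlock R) := by
  have hentry (i j : Fin 3) : R i ⬝ᵥ R j = if i = j then 1 else 0 := by
    simpa only [Matrix.mul_apply, Matrix.transpose_apply, Matrix.one_apply, dotProduct]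
      using congrFun₂ hR i j
  refine isLorentz_iff.2 fun μ ν => ?_
  refine Fin.cases (Fin.cases ?_ (fun j => ?_) ν) (fun i => Fin.cases ?_ (fun j => ?_) ν) μ
  · simp [spatialBlock, metric_zero_zero]
  · simp [spatialBlock, metric_zero_succ]
  · simp [spatialBlock, metric_succ_zero]
  · simp [spatialBlock, metric_succ_succ, hentry]

theorem radialCurrent_pull₂_spatialBlock (S : Spacetime → Fin 4 → Fin 4 → ℝ) (y : Spacetime) :
    radialCurrent (fun z => pull₂ (spatialBlock R) (S ((spatialBlock R).mulVec z + event T 0))) 0 y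
      = radialCurrent S 0 ((spatialBlock R).mulVec y + event T 0) := by
  have hcoord (j : Fin 3) : ((spatialBlock R).mulVec y + event T 0) j.succ
      = ∑ i : Fin 3, R j i * y i.succ := by
    simp [Matrix.mulVec, dotProduct, spatialBlock, event, Fin.sum_univ_succ]
  simp only [radialCurrent, pull₂, pull_spatialBlock_zero, pull_spatialBlock_succ, hcoord,
    Finset.mul_sum, Finset.sum_mul, smul_eq_mul]
  rw [Finset.sum_comm]
  exact Finset.sum_congr rfl fun j _ => Finset.sum_congr rfl fun i _ => by ring

theorem radialCurrent_massStress_pullback (hR : R * R.transpose = 1) (y : Spacetime) :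
    radialCurrent (fun z => massStress fun α => pullback (spatialBlock R) (event T 0) W α z) 0 y
      = radialCurrent (fun z => massStress fun α => W α z) 0
          ((spatialBlock R).mulVec y + event T 0) := by
  have hmass : (fun z => massStress fun α => pullback (spatialBlock R) (event T 0) W α z) = _ :=
    funext fun z => (isLorentz_spatialBlock hR).massStress_pull
      fun α => W α ((spatialBlock R).mulVec z + event T 0)
  rw [hmass]
  exact radialCurrent_pull₂_spatialBlock (fun z => massStress fun α => W α z) y

theorem IsProcaMaxwell.dilationCurrent_pullback (h : IsProcaMaxwell J m A W)
    (hR : R * R.transpose = 1) (y : Spacetime) :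
    dilationCurrent J m (pullback (spatialBlock R) (event T 0) A)
        (pullback (spatialBlock R) (event T 0) W) 0 y
      = dilationCurrent J m A W 0 ((spatialBlock R).mulVec y + event T 0) := by
  have hLorentz := isLorentz_spatialBlock hR
  have hstress : stress J m (pullback (spatialBlock R) (event T 0) A)
      (pullback (spatialBlock R) (event T 0) W) = _ := funext (hLorentz.stress_pullback h)
  rw [dilationCurrent, hstress, radialCurrent_pull₂_spatialBlock, dilationCurrent,
    hLorentz.virialCurrent_pullback h.contDiff_field, pullback, pull_spatialBlock_zero]

end SpatialBlock

section FirstVariation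

variable {V : Type*} [NormedAddCommGroup V] [InnerProductSpace ℝ V]

theorem hasDerivAt_add_smul (v w : V) : HasDerivAt (fun t : ℝ => v + t • w) w 0 := by
  simpa using ((hasDerivAt_id (0 : ℝ)).smul_const w).const_add v

theorem hasDerivAt_etaInner {a : ℝ → Fin 4 → V} {a' : Fin 4 → V} {t : ℝ}
    (ha : ∀ μ, HasDerivAt (fun s => a s μ) (a' μ) t) :
    HasDerivAt (fun s => etaInner (a s) (a s)) (2 * etaInner (a t) a') t := by
  have hsum := HasDerivAt.fun_sum (u := Finset.univ) fun μ _ =>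
    ((ha μ).inner ℝ (ha μ)).const_mul (eta μ)
  refine hsum.congr_deriv ?_
  simp only [real_inner_comm (a t _), ← two_mul, etaInner, Finset.mul_sum, mul_left_comm]

theorem hasDerivAt_etaInner₂ {G : ℝ → Fin 4 → Fin 4 → V} {G' : Fin 4 → Fin 4 → V} {t : ℝ}
    (hG : ∀ μ ν, HasDerivAt (fun s => G s μ ν) (G' μ ν) t) :
    HasDerivAt (fun s => etaInner₂ (G s) (G s)) (2 * etaInner₂ (G t) G') t := by
  have hsum := HasDerivAt.fun_sum (u := Finset.univ) fun μ _ =>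
    (hasDerivAt_etaInner (hG μ)).const_mul (eta μ)
  refine hsum.congr_deriv ?_
  simp only [etaInner₂, Finset.mul_sum, mul_left_comm]

theorem etaInner₂_smul_right (G : Fin 4 → Fin 4 → V) (a : Fin 4 → ℝ) (v : Fin 4 → V) :
    etaInner₂ G (fun μ ν => a μ • v ν) = etaInner (fun μ => etaInner (G μ) v) a := by
  simp only [etaInner₂, etaInner, real_inner_smul_right, Finset.mul_sum, RCLike.inner_apply,
    conj_trivial, mul_left_comm]

theorem etaInner_single_right (a : Fin 4 → ℝ) (μ : Fin 4) :
    etaInner a (Pi.single μ 1) = eta μ * a μ := by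
  rw [etaInner, Finset.sum_eq_single μ (fun α _ hα => by simp [hα]) (by simp)]
  simp

theorem eq_zero_of_forall_etaInner_eq_zero {a : Fin 4 → V} (ha : ∀ b, etaInner a b = 0) :
    a = 0 := by
  have hsum : ∑ μ, ‖a μ‖ ^ 2 = 0 := by
    simpa only [etaInner, real_inner_smul_right, ← mul_assoc, eta_mul_self, one_mul,
      real_inner_self_eq_norm_sq] using ha fun μ => eta μ • a μ
  funext μ
  simpa using (Finset.sum_eq_zero_iff_of_nonneg fun μ _ => sq_nonneg _).1 hsum μ (Finset.mem_univ μ)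

theorem divergence_etaInner_const {J : V →L[ℝ] V} (hJ : ∀ v w, ⟪J v, w⟫ = -⟪v, J w⟫)
    {A : Fin 4 → Spacetime → ℝ} {G : Fin 4 → Fin 4 → Spacetime → V}
    (hG : ∀ μ ν, ContDiff ℝ ∞ (G μ ν)) (v : Fin 4 → V) (x : Spacetime) :
    divergence (fun μ y => etaInner (fun ν => G μ ν y) v) x
      = etaInner (fun ν => gaugeDiv J A (fun μ => G μ ν) x) v
        - etaInner₂ (fun μ ν => G μ ν x) (fun μ ν => A μ x • J (v ν)) := by
  have hconst (μ ν : Fin 4) : gaugeDeriv J A μ (fun _ => v ν) x = -(A μ x • J (v ν)) := by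
    simp [gaugeDeriv, partialDeriv]
  refine (divergence_etaInner (A := A) (a := fun ν _ => v ν) hJ hG fun _ => contDiff_const).trans ?_
  simp only [hconst, etaInner₂_neg_right, ← sub_eq_add_neg]

end FirstVariation

section EulerLagrangeEquations

variable {e m : ℝ} {Ψ : Spacetime → FieldValue}

/-- The components `W⁺_μ` of the complex vector field. -/
def vectorPart (Ψ : Spacetime → FieldValue) (μ : Fin 4) (x : Spacetime) : ℂ := (Ψ x).1 μ

/-- The components `A_μ` of the electromagnetic potential. -/
def potentialPart (Ψ : Spacetime → FieldValue) (μ : Fin 4) (x : Spacetime) : ℝ := (Ψ x).2 μ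

/-- The generator of the gauge group, multiplication by `i e`. -/
def generator (e : ℝ) : ℂ →L[ℝ] ℂ := ContinuousLinearMap.mul ℝ ℂ (Complex.I * e)

theorem generator_apply (z : ℂ) : generator e z = Complex.I * e * z := rfl

theorem inner_generator_left (z w : ℂ) : ⟪generator e z, w⟫ = -⟪z, generator e w⟫ := by
  simp only [generator_apply, Complex.inner, Complex.mul_re, Complex.conj_re, Complex.conj_im,
    Complex.mul_im, Complex.I_re, Complex.I_im, Complex.ofReal_re, Complex.ofReal_im]
  ring

theorem contDiff_vectorPart (hΨ : ContDiff ℝ ∞ Ψ) (μ : Fin 4) : ContDiff ℝ ∞ (vectorPart Ψ μ) :=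
  (contDiff_apply ℝ ℂ μ).comp hΨ.fst

theorem contDiff_potentialPart (hΨ : ContDiff ℝ ∞ Ψ) (μ : Fin 4) :
    ContDiff ℝ ∞ (potentialPart Ψ μ) :=
  (contDiff_apply ℝ ℝ μ).comp hΨ.snd

theorem grad_fst (hΨ : ContDiff ℝ ∞ Ψ) (x : Spacetime) (μ ν : Fin 4) :
    (grad Ψ x μ).1 ν = partialDeriv μ (vectorPart Ψ ν) x :=
  (partialDeriv_clm_comp ((ContinuousLinearMap.proj ν).comp (ContinuousLinearMap.fst ℝ _ _))
    (differentiableAt_of_smooth hΨ) μ).symm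

theorem grad_snd (hΨ : ContDiff ℝ ∞ Ψ) (x : Spacetime) (μ ν : Fin 4) :
    (grad Ψ x μ).2 ν = partialDeriv μ (potentialPart Ψ ν) x :=
  (partialDeriv_clm_comp ((ContinuousLinearMap.proj ν).comp (ContinuousLinearMap.snd ℝ _ _))
    (differentiableAt_of_smooth hΨ) μ).symm

theorem strengthW_grad (hΨ : ContDiff ℝ ∞ Ψ) (x : Spacetime) (μ ν : Fin 4) :
    strengthW e (Ψ x) (grad Ψ x) μ ν
      = gaugeCurl (generator e) (potentialPart Ψ) (vectorPart Ψ) μ ν x := by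
  simp only [strengthW, covDeriv, grad_fst hΨ, gaugeCurl, gaugeDeriv, generator_apply,
    vectorPart, potentialPart, Complex.real_smul]
  ring

theorem strengthF_grad (hΨ : ContDiff ℝ ∞ Ψ) (x : Spacetime) (μ ν : Fin 4) :
    strengthF (grad Ψ x) μ ν = faraday (potentialPart Ψ) μ ν x := by
  simp only [strengthF, grad_snd hΨ, faraday]

theorem lagrangian_eq_etaInner (e m : ℝ) (u : FieldValue) (p : Fin 4 → FieldValue) :
    lagrangian e m u p
      = -(1 / 2) * etaInner₂ (strengthW e u p) (strengthW e u p) + m ^ 2 * etaInner u.1 u.1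
        - (1 / 4) * etaInner₂ (strengthF p) (strengthF p) := by
  simp only [lagrangian, etaInner₂, etaInner, real_inner_self_eq_norm_sq, Finset.mul_sum,
    mul_assoc, Real.norm_eq_abs, sq_abs]

theorem strengthW_antisymm (u : FieldValue) (p : Fin 4 → FieldValue) (μ ν : Fin 4) :
    strengthW e u p μ ν = -strengthW e u p ν μ :=
  (neg_sub _ _).symm

theorem strengthF_antisymm (p : Fin 4 → FieldValue) (μ ν : Fin 4) :
    strengthF p μ ν = -strengthF p ν μ :=
  (neg_sub _ _).symm

theorem hasDerivAt_covDeriv_line (u v : FieldValue) (p q : Fin 4 → FieldValue) (μ ν : Fin 4) :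
    HasDerivAt (fun t : ℝ => covDeriv e (u + t • v) (p + t • q) μ ν)
      ((q μ).1 ν - (u.2 μ • generator e (v.1 ν) + v.2 μ • generator e (u.1 ν))) 0 := by
  have hpotential := (hasDerivAt_add_smul (u.2 μ) (v.2 μ)).smul
    ((generator e).hasFDerivAt.comp_hasDerivAt (0 : ℝ) (hasDerivAt_add_smul (u.1 ν) (v.1 ν)))
  refine (((hasDerivAt_add_smul ((p μ).1 ν) ((q μ).1 ν)).sub hpotential).congr_deriv ?_)
    |>.congr_of_eventuallyEq (.of_forall fun t => ?_)
  · simp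
  · simp [covDeriv, generator_apply]
    ring

theorem hasDerivAt_lagrangian_line (u v : FieldValue) (p q : Fin 4 → FieldValue) :
    HasDerivAt (fun t : ℝ => lagrangian e m (u + t • v) (p + t • q))
      (-2 * etaInner₂ (strengthW e u p) (fun μ ν => (q μ).1 ν
          - (u.2 μ • generator e (v.1 ν) + v.2 μ • generator e (u.1 ν)))
        + 2 * m ^ 2 * etaInner u.1 v.1
        - etaInner₂ (strengthF p) (fun μ ν => (q μ).2 ν)) 0 := by
  have hcov := hasDerivAt_covDeriv_line (e := e) u v p q
  have hW (μ : Fin 4) : HasDerivAt (fun t : ℝ => (u + t • v).1 μ) (v.1 μ) 0 :=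
    hasDerivAt_add_smul (u.1 μ) (v.1 μ)
  have hF (μ ν : Fin 4) : HasDerivAt (fun t : ℝ => strengthF (p + t • q) μ ν)
      ((q μ).2 ν - (q ν).2 μ) 0 :=
    (hasDerivAt_add_smul ((p μ).2 ν) ((q μ).2 ν)).sub (hasDerivAt_add_smul ((p ν).2 μ) ((q ν).2 μ))
  have hG (μ ν : Fin 4) : HasDerivAt (fun t : ℝ => strengthW e (u + t • v) (p + t • q) μ ν)
      ((q μ).1 ν - (u.2 μ • generator e (v.1 ν) + v.2 μ • generator e (u.1 ν))
        - ((q ν).1 μ - (u.2 ν • generator e (v.1 μ) + v.2 ν • generator e (u.1 μ)))) 0 :=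
    (hcov μ ν).sub (hcov ν μ)
  simp only [lagrangian_eq_etaInner]
  refine ((((hasDerivAt_etaInner₂ hG).const_mul _).add ((hasDerivAt_etaInner hW).const_mul _)).sub
    ((hasDerivAt_etaInner₂ hF).const_mul _)).congr_deriv ?_
  simp only [zero_smul, add_zero]
  rw [etaInner₂_sub_swap_right (strengthF_antisymm p) fun μ ν => (q μ).2 ν]
  have hcurl := etaInner₂_sub_swap_right (strengthW_antisymm (e := e) u p) fun μ ν => (q μ).1 ν
    - (u.2 μ • generator e (v.1 ν) + v.2 μ • generator e (u.1 ν))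
  linear_combination -hcurl

theorem lineDeriv_lagrangian_derivatives (u : FieldValue) (p : Fin 4 → FieldValue) (μ : Fin 4)
    (v : FieldValue) :
    lineDeriv ℝ (lagrangian e m u) p (Pi.single μ v)
      = -(eta μ * (2 * etaInner (strengthW e u p μ) v.1 + etaInner (strengthF p μ) v.2)) := by
  have hsingle (α : Fin 4) : (Pi.single μ v : Fin 4 → FieldValue) α
      = (Pi.single μ 1 : Fin 4 → ℝ) α • v := by
    rcases eq_or_ne α μ with rfl | hα <;> simp [*]
  have h := (hasDerivAt_lagrangian_line (e := e) (m := m) u 0 p (Pi.single μ v)).deriv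
  simp only [smul_zero, add_zero, hsingle, Prod.smul_fst, Prod.smul_snd, Prod.fst_zero,
    Prod.snd_zero, Pi.smul_apply, Pi.zero_apply, map_zero, zero_smul, sub_zero,
    etaInner₂_smul_right, etaInner_single_right, etaInner_zero_right] at h
  exact h.trans (by ring)

theorem lineDeriv_lagrangian_fields (u : FieldValue) (p : Fin 4 → FieldValue) (v : FieldValue) :
    lineDeriv ℝ (fun u => lagrangian e m u p) u v
      = 2 * etaInner₂ (strengthW e u p)
          (fun μ ν => u.2 μ • generator e (v.1 ν) + v.2 μ • generator e (u.1 ν))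
        + 2 * m ^ 2 * etaInner u.1 v.1 := by
  have h := (hasDerivAt_lagrangian_line (e := e) (m := m) u v p 0).deriv
  have hzero : etaInner₂ (strengthF p) (fun _ _ => (0 : ℝ)) = 0 := etaInner₂_zero_right _
  simp only [smul_zero, add_zero, Pi.zero_apply, Prod.fst_zero, Prod.snd_zero, zero_sub,
    etaInner₂_neg_right, hzero] at h
  exact h.trans (by ring)

theorem sum_partialDeriv_lineDeriv_lagrangian (hΨ : ContDiff ℝ ∞ Ψ) (x : Spacetime)
    (v : FieldValue) :
    ∑ μ, partialDeriv μ
        (fun y => lineDeriv ℝ (lagrangian e m (Ψ y)) (grad Ψ y) (Pi.single μ v)) x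
      = -(2 * divergence (fun μ y => etaInner (fun ν =>
            gaugeCurl (generator e) (potentialPart Ψ) (vectorPart Ψ) μ ν y) v.1) x
        + divergence (fun μ y => etaInner (fun ν => faraday (potentialPart Ψ) μ ν y) v.2) x) := by
  have hG (μ : Fin 4) := contDiff_etaInner (contDiff_gaugeCurl (J := generator e)
    (contDiff_potentialPart hΨ) (contDiff_vectorPart hΨ) μ) (b := fun ν _ => v.1 ν)
    fun _ => contDiff_const
  have hF (μ : Fin 4) := contDiff_etaInner (contDiff_faraday (contDiff_potentialPart hΨ) μ)
    (b := fun ν _ => v.2 ν) fun _ => contDiff_const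
  have hmomentum (μ : Fin 4) (y : Spacetime) :
      lineDeriv ℝ (lagrangian e m (Ψ y)) (grad Ψ y) (Pi.single μ v)
        = -eta μ • ((2 : ℝ) • etaInner (fun ν =>
            gaugeCurl (generator e) (potentialPart Ψ) (vectorPart Ψ) μ ν y) v.1
          + etaInner (fun ν => faraday (potentialPart Ψ) μ ν y) v.2) := by
    rw [lineDeriv_lagrangian_derivatives]
    simp only [etaInner, strengthW_grad hΨ, strengthF_grad hΨ, smul_eq_mul]
    ring
  simp only [divergence, Finset.mul_sum, ← Finset.sum_add_distrib, ← Finset.sum_neg_distrib]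
  refine Finset.sum_congr rfl fun μ _ => ?_
  have hGμ := differentiableAt_of_smooth (hG μ) (x := x)
  have hFμ := differentiableAt_of_smooth (hF μ) (x := x)
  rw [funext (hmomentum μ), partialDeriv_const_smul _ ((hGμ.fun_const_smul (2 : ℝ)).fun_add hFμ),
    partialDeriv_add (hGμ.fun_const_smul (2 : ℝ)) hFμ, partialDeriv_const_smul _ hGμ]
  simp only [smul_eq_mul]
  ring

theorem EulerLagrange.etaInner_gaugeDiv_add (h : EulerLagrange (lagrangian e m) Ψ)
    (hΨ : ContDiff ℝ ∞ Ψ) (x : Spacetime) (v : FieldValue) :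
    2 * etaInner (fun ν => gaugeDiv (generator e) (potentialPart Ψ) (fun μ =>
          gaugeCurl (generator e) (potentialPart Ψ) (vectorPart Ψ) μ ν) x) v.1
        + etaInner (fun ν => divergence (fun μ => faraday (potentialPart Ψ) μ ν) x) v.2
      = -(2 * m ^ 2 * etaInner (fun ν => vectorPart Ψ ν x) v.1)
        - 2 * etaInner₂
          (fun μ ν => gaugeCurl (generator e) (potentialPart Ψ) (vectorPart Ψ) μ ν x)
          (fun μ ν => v.2 μ • generator e (vectorPart Ψ ν x)) := by
  have hG := contDiff_gaugeCurl (J := generator e) (contDiff_potentialPart hΨ)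
    (contDiff_vectorPart hΨ)
  have hdivG := divergence_etaInner_const (A := potentialPart Ψ) (inner_generator_left (e := e)) hG
    v.1 x
  have hdivF := divergence_etaInner_const (J := 0) (A := potentialPart Ψ)
    (fun v w => by simp) (contDiff_faraday (contDiff_potentialPart hΨ)) v.2 x
  have hzero : etaInner₂ (fun μ ν => faraday (potentialPart Ψ) μ ν x) (fun _ _ => (0 : ℝ)) = 0 :=
    etaInner₂_zero_right _
  have hEL := h x v
  have hstrengthW : strengthW e (Ψ x) (grad Ψ x) = fun μ ν =>
      gaugeCurl (generator e) (potentialPart Ψ) (vectorPart Ψ) μ ν x :=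
    funext₂ (strengthW_grad hΨ x)
  rw [sum_partialDeriv_lineDeriv_lagrangian hΨ, lineDeriv_lagrangian_fields, hstrengthW,
    etaInner₂_add_right, hdivG, hdivF] at hEL
  simp only [gaugeDiv_zero, zero_apply, smul_zero, hzero, sub_zero] at hEL
  simp only [vectorPart, potentialPart] at hEL ⊢
  linarith

theorem EulerLagrange.isProcaMaxwell (h : EulerLagrange (lagrangian e m) Ψ)
    (hΨ : ContDiff ℝ ∞ Ψ) :
    IsProcaMaxwell (generator e) m (potentialPart Ψ) (vectorPart Ψ) where
  contDiff_potential := contDiff_potentialPart hΨ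
  contDiff_field := contDiff_vectorPart hΨ
  proca ν x := by
    refine eq_neg_of_add_eq_zero_left (congrFun (eq_zero_of_forall_etaInner_eq_zero
      (a := fun ν => gaugeDiv (generator e) (potentialPart Ψ) (fun μ =>
        gaugeCurl (generator e) (potentialPart Ψ) (vectorPart Ψ) μ ν) x
          + m ^ 2 • vectorPart Ψ ν x) fun b => ?_) ν)
    have hb := h.etaInner_gaugeDiv_add hΨ x (b, 0)
    simp only [etaInner₂_smul_right, etaInner_zero_right, mul_zero, add_zero, sub_zero] at hb
    simp only [etaInner] at hb
    simp only [etaInner, inner_add_left, real_inner_smul_left, mul_add, Finset.sum_add_distrib,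
      mul_left_comm _ (m ^ 2), ← Finset.mul_sum]
    linarith
  maxwell ρ x := by
    refine sub_eq_zero.1 (congrFun (eq_zero_of_forall_etaInner_eq_zero
      (a := fun ρ => divergence (fun μ => faraday (potentialPart Ψ) μ ρ) x
        - 2 * etaInner (fun σ => generator e
            (gaugeCurl (generator e) (potentialPart Ψ) (vectorPart Ψ) ρ σ x))
          (fun σ => vectorPart Ψ σ x)) fun b => ?_) ρ)
    have hb := h.etaInner_gaugeDiv_add hΨ x (0, b)
    simp only [etaInner_zero_right] at hb
    simp only [etaInner₂_smul_right, etaInner] at hb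
    simp only [etaInner, inner_generator_left, inner_sub_left, mul_sub, Finset.sum_sub_distrib,
      mul_neg, Finset.sum_neg_distrib, inner_neg_left, ← smul_eq_mul (2 : ℝ), real_inner_smul_left]
    simp only [smul_eq_mul, mul_left_comm _ (2 : ℝ), ← Finset.mul_sum, mul_neg,
      Finset.sum_neg_distrib]
    linarith

end EulerLagrangeEquations

section Bounds

section

variable {V : Type*} [NormedAddCommGroup V]

theorem sum_norm_sq_eq_zero_iff {ι : Type*} [Fintype ι] {v : ι → V} :
    ∑ i, ‖v i‖ ^ 2 = 0 ↔ ∀ i, v i = 0 := by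
  simp [Finset.sum_eq_zero_iff_of_nonneg]

theorem sum_sum_norm_sq_eq_zero_iff {ι : Type*} [Fintype ι] {G : ι → ι → V} :
    ∑ i, ∑ j, ‖G i j‖ ^ 2 = 0 ↔ ∀ i j, G i j = 0 := by
  rw [Finset.sum_eq_zero_iff_of_nonneg fun _ _ => Finset.sum_nonneg fun _ _ => sq_nonneg _]
  simp only [Finset.mem_univ, true_imp_iff, sum_norm_sq_eq_zero_iff]

theorem norm_sq_le_sum (w : Fin 4 → V) (μ : Fin 4) : ‖w μ‖ ^ 2 ≤ ∑ ν, ‖w ν‖ ^ 2 :=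
  Finset.single_le_sum (f := fun ν => ‖w ν‖ ^ 2) (fun _ _ => sq_nonneg _) (Finset.mem_univ μ)

theorem sum_norm_sq_le_sum (G : Fin 4 → Fin 4 → V) (μ : Fin 4) :
    ∑ ν, ‖G μ ν‖ ^ 2 ≤ ∑ α, ∑ ν, ‖G α ν‖ ^ 2 :=
  Finset.single_le_sum (f := fun α => ∑ ν, ‖G α ν‖ ^ 2)
    (fun _ _ => Finset.sum_nonneg fun _ _ => sq_nonneg _) (Finset.mem_univ μ)

end

variable {V : Type*} [NormedAddCommGroup V] [InnerProductSpace ℝ V] {J : V →L[ℝ] V} {m : ℝ}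
  {A : Fin 4 → Spacetime → ℝ} {W : Fin 4 → Spacetime → V}

theorem abs_eta (μ : Fin 4) : |eta μ| = 1 := by
  fin_cases μ <;> simp [eta]

theorem abs_metric_le_one (μ ν : Fin 4) : |metric μ ν| ≤ 1 := by
  rw [metric]
  split_ifs <;> simp [abs_eta]

theorem abs_inner_le_half_add_sq (v w : V) : |⟪v, w⟫| ≤ (1 / 2) * (‖v‖ ^ 2 + ‖w‖ ^ 2) := by
  linarith [abs_real_inner_le_norm v w, two_mul_le_add_sq ‖v‖ ‖w‖]

theorem abs_etaInner_le (a b : Fin 4 → V) :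
    |etaInner a b| ≤ (1 / 2) * (∑ μ, ‖a μ‖ ^ 2 + ∑ μ, ‖b μ‖ ^ 2) := by
  rw [← Finset.sum_add_distrib, Finset.mul_sum]
  refine (Finset.abs_sum_le_sum_abs _ _).trans (Finset.sum_le_sum fun μ _ => ?_)
  rw [abs_mul, abs_eta, one_mul]
  exact abs_inner_le_half_add_sq _ _

theorem abs_etaInner₂_self_le (G : Fin 4 → Fin 4 → V) :
    |etaInner₂ G G| ≤ ∑ μ, ∑ ν, ‖G μ ν‖ ^ 2 := by
  refine (Finset.abs_sum_le_sum_abs _ _).trans (Finset.sum_le_sum fun μ _ => ?_)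
  rw [abs_mul, abs_eta, one_mul]
  linarith [abs_etaInner_le (G μ) (G μ)]

theorem abs_metric_mul_le (μ ν : Fin 4) (c : ℝ) : |metric μ ν * c| ≤ |c| := by
  rw [abs_mul]
  exact mul_le_of_le_one_left (abs_nonneg c) (abs_metric_le_one μ ν)

theorem abs_massStress_le (w : Fin 4 → V) (μ ν : Fin 4) :
    |massStress w μ ν| ≤ 2 * ∑ α, ‖w α‖ ^ 2 := by
  have htrace : |(1 / 2) * etaInner w w| ≤ ∑ α, ‖w α‖ ^ 2 := by
    rw [abs_mul, abs_of_pos one_half_pos]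
    linarith [abs_etaInner_le w w, abs_nonneg (etaInner w w)]
  rw [massStress]
  linarith [abs_sub ⟪w μ, w ν⟫ (metric μ ν * ((1 / 2) * etaInner w w)),
    abs_inner_le_half_add_sq (w μ) (w ν), norm_sq_le_sum w μ, norm_sq_le_sum w ν,
    abs_metric_mul_le μ ν ((1 / 2) * etaInner w w)]

theorem abs_gaugeStress_le (G : Fin 4 → Fin 4 → V) (μ ν : Fin 4) :
    |gaugeStress G μ ν| ≤ 2 * ∑ α, ∑ β, ‖G α β‖ ^ 2 := by
  have htrace : |(1 / 4) * etaInner₂ G G| ≤ ∑ α, ∑ β, ‖G α β‖ ^ 2 := by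
    rw [abs_mul, abs_of_pos (by norm_num)]
    linarith [abs_etaInner₂_self_le G, abs_nonneg (etaInner₂ G G)]
  rw [gaugeStress]
  linarith [abs_sub (etaInner (G μ) (G ν)) (metric μ ν * ((1 / 4) * etaInner₂ G G)),
    abs_etaInner_le (G μ) (G ν), sum_norm_sq_le_sum G μ, sum_norm_sq_le_sum G ν,
    abs_metric_mul_le μ ν ((1 / 4) * etaInner₂ G G)]

theorem sum_norm_sq_of_antisymm {G : Fin 4 → Fin 4 → V} (hG : ∀ μ ν, G μ ν = -G ν μ) :
    ∑ μ, ∑ ν, ‖G μ ν‖ ^ 2 = 2 * (∑ i : Fin 3, ‖G 0 i.succ‖ ^ 2)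
      + ∑ i : Fin 3, ∑ j : Fin 3, ‖G i.succ j.succ‖ ^ 2 := by
  have := IsAddTorsionFree.of_isTorsionFree ℝ V
  have hdiag : G 0 0 = 0 := self_eq_neg.mp (hG 0 0)
  have hside (i : Fin 3) : ‖G i.succ 0‖ = ‖G 0 i.succ‖ := by rw [hG, norm_neg]
  simp only [Fin.sum_univ_succ (n := 3), hdiag, hside, norm_zero, Finset.sum_add_distrib]
  ring

/-- The sum of the squares of all components of the field strengths and of the field: a positive
density which dominates all the quadratic currents. -/
def squareDensity (J : V →L[ℝ] V) (A : Fin 4 → Spacetime → ℝ) (W : Fin 4 → Spacetime → V)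
    (y : Spacetime) : ℝ :=
  (∑ μ, ∑ ν, ‖gaugeCurl J A W μ ν y‖ ^ 2) + (∑ μ, ‖W μ y‖ ^ 2) + ∑ μ, ∑ ν, ‖faraday A μ ν y‖ ^ 2

theorem squareDensity_eq (y : Spacetime) :
    squareDensity J A W y
      = 2 * (∑ i : Fin 3, ‖gaugeCurl J A W 0 i.succ y‖ ^ 2)
        + (∑ i : Fin 3, ∑ j : Fin 3, ‖gaugeCurl J A W i.succ j.succ y‖ ^ 2)
        + ‖W 0 y‖ ^ 2 + (∑ i : Fin 3, ‖W i.succ y‖ ^ 2)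
        + 2 * (∑ i : Fin 3, ‖faraday A 0 i.succ y‖ ^ 2)
        + ∑ i : Fin 3, ∑ j : Fin 3, ‖faraday A i.succ j.succ y‖ ^ 2 := by
  rw [squareDensity,
    sum_norm_sq_of_antisymm fun μ ν => congrFun (gaugeCurl_antisymm (J := J) (A := A) W μ ν) y,
    sum_norm_sq_of_antisymm fun μ ν => congrFun (faraday_antisymm (A := A) μ ν) y,
    Fin.sum_univ_succ fun μ => ‖W μ y‖ ^ 2]
  ring

theorem abs_virialCurrent_le (μ : Fin 4) (y : Spacetime) :
    |virialCurrent J A W μ y| ≤ squareDensity J A W y := by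
  have hF : 0 ≤ ∑ μ, ∑ ν, ‖faraday A μ ν y‖ ^ 2 := by positivity
  have hW : 0 ≤ ∑ μ, ‖W μ y‖ ^ 2 := by positivity
  have hG : 0 ≤ ∑ ν, ‖gaugeCurl J A W μ ν y‖ ^ 2 := by positivity
  rw [virialCurrent, squareDensity]
  linarith [abs_etaInner_le (fun ρ => gaugeCurl J A W μ ρ y) (fun ρ => W ρ y),
    sum_norm_sq_le_sum (fun α β => gaugeCurl J A W α β y) μ]

theorem abs_stress_le (y : Spacetime) (μ ν : Fin 4) :
    |stress J m A W y μ ν| ≤ (4 * m ^ 2 + 4) * squareDensity J A W y := by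
  have hF : 0 ≤ ∑ μ, ∑ ν, ‖faraday A μ ν y‖ ^ 2 := by positivity
  have hW : 0 ≤ ∑ μ, ‖W μ y‖ ^ 2 := by positivity
  have hG : 0 ≤ ∑ μ, ∑ ν, ‖gaugeCurl J A W μ ν y‖ ^ 2 := by positivity
  have hmass := mul_le_mul_of_nonneg_left (abs_massStress_le (fun α => W α y) μ ν)
    (by positivity : 0 ≤ 2 * m ^ 2)
  have hcurl := abs_gaugeStress_le (fun α β => gaugeCurl J A W α β y) μ ν
  have hfaraday := abs_gaugeStress_le (fun α β => faraday A α β y) μ ν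
  have htriangle := (abs_sub _ (gaugeStress (fun α β => faraday A α β y) μ ν)).trans
    (add_le_add_left (abs_sub (2 * m ^ 2 * massStress (fun α => W α y) μ ν)
      (2 * gaugeStress (fun α β => gaugeCurl J A W α β y) μ ν)) _)
  rw [abs_mul (2 * m ^ 2), abs_of_nonneg (by positivity : 0 ≤ 2 * m ^ 2),
    abs_mul 2 (gaugeStress _ μ ν), abs_two] at htriangle
  rw [stress, squareDensity]
  nlinarith [mul_nonneg (sq_nonneg m) (add_nonneg hG hF)]

theorem abs_radialCurrent_le {S : Spacetime → Fin 4 → Fin 4 → ℝ} {y : Spacetime} {B : ℝ}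
    {μ : Fin 4} (hS : ∀ k : Fin 3, |S y μ k.succ| ≤ B) :
    |radialCurrent S μ y| ≤ ‖spatial y‖ * (3 * B) := by
  calc |radialCurrent S μ y|
    _ ≤ ∑ k : Fin 3, |y k.succ * S y μ k.succ| := Finset.abs_sum_le_sum_abs _ _
    _ ≤ ∑ _k : Fin 3, ‖spatial y‖ * B := Finset.sum_le_sum fun k _ => by
        rw [abs_mul]
        exact mul_le_mul (norm_le_pi_norm (spatial y) k) (hS k) (abs_nonneg _) (norm_nonneg _)
    _ = ‖spatial y‖ * (3 * B) := by
        rw [Finset.sum_const, Finset.card_univ, Fintype.card_fin, nsmul_eq_mul]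
        push_cast
        ring

theorem squareDensity_nonneg (y : Spacetime) : 0 ≤ squareDensity J A W y := by
  rw [squareDensity]
  positivity

theorem sum_norm_sq_field_le_squareDensity (y : Spacetime) :
    ∑ μ, ‖W μ y‖ ^ 2 ≤ squareDensity J A W y := by
  have hcurl : 0 ≤ ∑ μ, ∑ ν, ‖gaugeCurl J A W μ ν y‖ ^ 2 := by positivity
  have hfaraday : 0 ≤ ∑ μ, ∑ ν, ‖faraday A μ ν y‖ ^ 2 := by positivity
  rw [squareDensity]
  linarith

theorem abs_dilationCurrent_le (μ : Fin 4) (y : Spacetime) :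
    |dilationCurrent J m A W μ y|
      ≤ (1 + ‖spatial y‖) * ((12 * m ^ 2 + 12) * squareDensity J A W y) := by
  have hvirial : |virialCurrent J A W μ y| ≤ (12 * m ^ 2 + 12) * squareDensity J A W y :=
    (abs_virialCurrent_le μ y).trans
      (le_mul_of_one_le_left (squareDensity_nonneg y) (by nlinarith [sq_nonneg m]))
  have hradial := abs_radialCurrent_le fun k => abs_stress_le (J := J) (m := m) (A := A) (W := W)
    y μ k.succ
  rw [dilationCurrent]
  linarith [abs_sub (virialCurrent J A W μ y) (radialCurrent (stress J m A W) μ y)]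

theorem abs_radialCurrent_massStress_le (μ : Fin 4) (y : Spacetime) :
    |radialCurrent (fun z => massStress fun α => W α z) μ y|
      ≤ (1 + ‖spatial y‖) * (6 * squareDensity J A W y) := by
  have hmass (k : Fin 3) : |massStress (fun α => W α y) μ k.succ| ≤ 2 * squareDensity J A W y :=
    (abs_massStress_le _ _ _).trans
      (mul_le_mul_of_nonneg_left (sum_norm_sq_field_le_squareDensity y) zero_le_two)
  have hradial := abs_radialCurrent_le (S := fun z => massStress fun α => W α z) hmass
  linarith [squareDensity_nonneg (J := J) (A := A) (W := W) y]

end Bounds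

section Vanishing

variable {V : Type*} [NormedAddCommGroup V] [InnerProductSpace ℝ V] {J : V →L[ℝ] V} {m T : ℝ}
  {A : Fin 4 → Spacetime → ℝ} {W : Fin 4 → Spacetime → V}

theorem slab_subset_closure_interior (hT : 0 < T) : slab T ⊆ closure (interior (slab T)) := by
  have hopen := isOpenMap_eval (X := fun _ : Fin 4 => ℝ) 0
  have hslab : slab T = Function.eval 0 ⁻¹' Set.Icc 0 T := rfl
  rw [hslab, ← hopen.preimage_interior_eq_interior_preimage (continuous_apply 0),
    ← hopen.preimage_closure_eq_closure_preimage (continuous_apply 0), interior_Icc,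
    closure_Ioo hT.ne]

theorem eq_zero_of_setIntegral_slab_eq_zero (hT : 0 < T) {g : Spacetime → ℝ} (hg : Continuous g)
    (hnonneg : ∀ y, 0 ≤ g y) (hintg : IntegrableOn g (slab T)) (hzero : ∫ y in slab T, g y = 0)
    {y : Spacetime} (hy : y ∈ slab T) : g y = 0 :=
  Measure.eqOn_of_ae_eq ((integral_eq_zero_iff_of_nonneg hnonneg hintg).1 hzero) hg.continuousOn
    continuousOn_const (slab_subset_closure_interior hT) hy

theorem integrableOn_of_abs_le_squareDensity (hfin : IntegrableOn (squareDensity J A W) (slab T))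
    {f : Spacetime → ℝ} (hf : Continuous f) {C : ℝ}
    (hbound : ∀ y, |f y| ≤ C * squareDensity J A W y) : IntegrableOn f (slab T) :=
  (hfin.const_mul C).mono' hf.aestronglyMeasurable (.of_forall hbound)

theorem event_add_event (s t : ℝ) (x y : Fin 3 → ℝ) :
    event s x + event t y = event (s + t) (x + y) :=
  Matrix.cons_add_cons s x t y

theorem IsLorentz.pullback_eq_zero_iff {M : Matrix (Fin 4) (Fin 4) ℝ} (hM : IsLorentz M)
    {c : Spacetime} (hA : ∀ μ, ContDiff ℝ ∞ (A μ)) (y : Spacetime) :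
    ((∀ μ, pullback M c W μ y = 0) ∧ ∀ μ ν, faraday (pullback M c A) μ ν y = 0)
      ↔ (∀ μ, W μ (M.mulVec y + c) = 0) ∧ ∀ μ ν, faraday A μ ν (M.mulVec y + c) = 0 := by
  have hfield := hM.pull_eq_zero_iff (a := fun μ => W μ (M.mulVec y + c))
  have hfaraday := hM.pull₂_eq_zero_iff (S := fun μ ν => faraday A μ ν (M.mulVec y + c))
  simp only [funext_iff, Pi.zero_apply] at hfield hfaraday
  simp only [faraday_pullback hA, hfaraday, pullback, hfield]

theorem radialCurrent_massStress_event_mulVec {R : Matrix (Fin 3) (Fin 3) ℝ}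
    (hR : R * R.transpose = 1) (hW : pullback (spatialBlock R) (event T 0) W = W)
    (x : Fin 3 → ℝ) :
    radialCurrent (fun z => massStress fun α => W α z) 0 (event T (R.mulVec x))
      = radialCurrent (fun z => massStress fun α => W α z) 0 (event 0 x) := by
  have hshift := radialCurrent_massStress_pullback (W := W) (T := T) hR (event 0 x)
  rwa [hW, spatialBlock_mulVec_event, event_add_event, zero_add, add_zero, eq_comm] at hshift

namespace IsProcaMaxwell

variable (h : IsProcaMaxwell J m A W)
include h

theorem divergence_dilationCurrent_nonneg (hJ : ∀ v w, ⟪J v, w⟫ = -⟪v, J w⟫) (y : Spacetime) :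
    0 ≤ divergence (dilationCurrent J m A W) y := by
  rw [h.divergence_dilationCurrent hJ]
  positivity

theorem divergence_dilationCurrent_le (hJ : ∀ v w, ⟪J v, w⟫ = -⟪v, J w⟫) (y : Spacetime) :
    divergence (dilationCurrent J m A W) y ≤ (2 * m ^ 2 + 1) * squareDensity J A W y := by
  have hmass : m ^ 2 * ‖W 0 y‖ ^ 2 ≤ m ^ 2 * squareDensity J A W y :=
    mul_le_mul_of_nonneg_left ((norm_sq_le_sum (fun μ => W μ y) 0).trans
      (sum_norm_sq_field_le_squareDensity y)) (sq_nonneg m)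
  have hfield : 0 ≤ ∑ i : Fin 3, ‖W i.succ y‖ ^ 2 := by positivity
  have hcurl : 0 ≤ ∑ i : Fin 3, ‖gaugeCurl J A W 0 i.succ y‖ ^ 2 := by positivity
  have helectric : 0 ≤ ∑ i : Fin 3, ‖faraday A 0 i.succ y‖ ^ 2 := by positivity
  have hmagnetic : 0 ≤ ∑ i : Fin 3, ∑ j : Fin 3, ‖faraday A i.succ j.succ y‖ ^ 2 :=
    Finset.sum_nonneg fun _ _ => Finset.sum_nonneg fun _ _ => sq_nonneg _
  rw [h.divergence_dilationCurrent hJ]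
  linarith [squareDensity_eq (J := J) (A := A) (W := W) y, sq_nonneg ‖W 0 y‖]

theorem dilationCurrent_event_mulVec {R : Matrix (Fin 3) (Fin 3) ℝ} (hR : R * R.transpose = 1)
    (hA : pullback (spatialBlock R) (event T 0) A = A)
    (hW : pullback (spatialBlock R) (event T 0) W = W) (x : Fin 3 → ℝ) :
    dilationCurrent J m A W 0 (event T (R.mulVec x)) = dilationCurrent J m A W 0 (event 0 x) := by
  have hshift := h.dilationCurrent_pullback (T := T) hR (event 0 x)
  rwa [hA, hW, spatialBlock_mulVec_event, event_add_event, zero_add, add_zero, eq_comm] at hshift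

theorem divergence_dilationCurrent_eq_zero_of_mem_slab (hJ : ∀ v w, ⟪J v, w⟫ = -⟪v, J w⟫)
    (hT : 0 < T) {R : Matrix (Fin 3) (Fin 3) ℝ} (hR : R * R.transpose = 1)
    (hA : pullback (spatialBlock R) (event T 0) A = A)
    (hW : pullback (spatialBlock R) (event T 0) W = W)
    (hfin : IntegrableOn (squareDensity J A W) (slab T)) {y : Spacetime} (hy : y ∈ slab T) :
    divergence (dilationCurrent J m A W) y = 0 := by
  have hcont := (contDiff_divergence h.contDiff_dilationCurrent).continuous
  have hintg : IntegrableOn (divergence (dilationCurrent J m A W)) (slab T) :=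
    integrableOn_of_abs_le_squareDensity hfin hcont fun y => by
      rw [abs_of_nonneg (h.divergence_dilationCurrent_nonneg hJ y)]
      exact h.divergence_dilationCurrent_le hJ y
  refine eq_zero_of_setIntegral_slab_eq_zero hT hcont (h.divergence_dilationCurrent_nonneg hJ) hintg
    ?_ hy
  exact integral_divergence_eq_zero h.contDiff_dilationCurrent hT.le hR
    (h.dilationCurrent_event_mulVec hR hA hW)
    (hfin.const_mul (12 * m ^ 2 + 12))
    (fun y => (pi_norm_le_iff_of_nonempty _).2 fun k => abs_dilationCurrent_le k.succ y) hintg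

theorem eq_zero_of_divergence_dilationCurrent_eq_zero (hJ : ∀ v w, ⟪J v, w⟫ = -⟪v, J w⟫)
    (hm : m ≠ 0) {y : Spacetime} (hy : divergence (dilationCurrent J m A W) y = 0) :
    W 0 y = 0 ∧ (∀ i j : Fin 3, gaugeCurl J A W i.succ j.succ y = 0) ∧
      ∀ μ ν, faraday A μ ν y = 0 := by
  have hcharge : 0 ≤ m ^ 2 * ‖W 0 y‖ ^ 2 := by positivity
  have hcurl : 0 ≤ ∑ i : Fin 3, ∑ j : Fin 3, ‖gaugeCurl J A W i.succ j.succ y‖ ^ 2 := by positivity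
  have helectric : 0 ≤ ∑ i : Fin 3, ‖faraday A 0 i.succ y‖ ^ 2 := by positivity
  have hmagnetic : 0 ≤ ∑ i : Fin 3, ∑ j : Fin 3, ‖faraday A i.succ j.succ y‖ ^ 2 :=
    Finset.sum_nonneg fun _ _ => Finset.sum_nonneg fun _ _ => sq_nonneg _
  have hfaraday := sum_norm_sq_of_antisymm (G := fun μ ν => faraday A μ ν y)
    fun μ ν => congrFun (faraday_antisymm μ ν) y
  rw [h.divergence_dilationCurrent hJ] at hy
  have hmass_zero : m ^ 2 * ‖W 0 y‖ ^ 2 = 0 := by linarith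
  have hcurl_zero : ∑ i : Fin 3, ∑ j : Fin 3, ‖gaugeCurl J A W i.succ j.succ y‖ ^ 2 = 0 := by
    linarith
  have hfaraday_zero : ∑ μ, ∑ ν, ‖faraday A μ ν y‖ ^ 2 = 0 := by linarith
  exact ⟨by simpa [hm] using hmass_zero, sum_sum_norm_sq_eq_zero_iff.1 hcurl_zero,
    sum_sum_norm_sq_eq_zero_iff.1 hfaraday_zero⟩

theorem divergence_radialCurrent_massStress_of_eq_zero (hJ : ∀ v w, ⟪J v, w⟫ = -⟪v, J w⟫)
    (hm : m ≠ 0) {y : Spacetime} (hcharge : W 0 y = 0)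
    (hcurl : ∀ i j : Fin 3, gaugeCurl J A W i.succ j.succ y = 0)
    (hfaraday : ∀ μ ν, faraday A μ ν y = 0) :
    divergence (radialCurrent fun z => massStress fun α => W α z) y
      = (1 / 2) * ∑ k : Fin 3, ‖W k.succ y‖ ^ 2 := by
  have hforce (k : Fin 3) :
      divergence (fun μ z => massStress (fun α => W α z) μ k.succ) y = 0 := by
    have hbalance := h.divergence_massStress hJ y k.succ
    have helectric : etaInner (fun μ => W μ y) (fun μ => gaugeCurl J A W μ k.succ y) = 0 := by
      simp [etaInner, Fin.sum_univ_succ (n := 3), hcharge, hcurl]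
    have hlorentz : (fun α β => faraday A α β y • J (W k.succ y)) = 0 := by
      simp only [hfaraday, zero_smul]
      rfl
    rw [helectric, hlorentz, etaInner₂_zero_right] at hbalance
    simpa [hm] using hbalance
  rw [divergence_radialCurrent (contDiff_massStress h.contDiff_field)]
  simp only [hforce, mul_zero, zero_sub, Finset.sum_neg_distrib]
  rw [sum_massStress_self, hcharge, norm_zero]
  ring

theorem field_eq_zero_of_mem_slab (hT : 0 < T) {R : Matrix (Fin 3) (Fin 3) ℝ}
    (hR : R * R.transpose = 1)
    (hW : pullback (spatialBlock R) (event T 0) W = W)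
    (hfin : IntegrableOn (squareDensity J A W) (slab T)) (hcharge : ∀ y ∈ slab T, W 0 y = 0)
    (hdiv : ∀ y ∈ slab T, divergence (radialCurrent fun z => massStress fun α => W α z) y
      = (1 / 2) * ∑ k : Fin 3, ‖W k.succ y‖ ^ 2)
    {y : Spacetime} (hy : y ∈ slab T) (μ : Fin 4) : W μ y = 0 := by
  have hcont : Continuous fun z => (1 / 2) * ∑ k : Fin 3, ‖W k.succ z‖ ^ 2 :=
    continuous_const.mul (continuous_finsetSum _ fun k _ =>
      (h.contDiff_field k.succ).continuous.norm.pow 2)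
  have hintg : IntegrableOn (fun z => (1 / 2) * ∑ k : Fin 3, ‖W k.succ z‖ ^ 2) (slab T) := by
    refine integrableOn_of_abs_le_squareDensity (C := 1) hfin hcont fun z => ?_
    have hfield := sum_norm_sq_field_le_squareDensity (J := J) (A := A) (W := W) z
    have hspatial : 0 ≤ ∑ k : Fin 3, ‖W k.succ z‖ ^ 2 := by positivity
    rw [Fin.sum_univ_succ] at hfield
    rw [abs_of_nonneg (by positivity)]
    linarith [sq_nonneg ‖W 0 z‖]
  have hzero := integral_divergence_eq_zero
    (contDiff_radialCurrent (contDiff_massStress h.contDiff_field)) hT.le hR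
    (radialCurrent_massStress_event_mulVec hR hW) (hfin.const_mul 6)
    (fun z => (pi_norm_le_iff_of_nonempty _).2 fun k => abs_radialCurrent_massStress_le k.succ z)
    (hintg.congr_fun (fun z hz => (hdiv z hz).symm) (measurableSet_slab T))
  rw [setIntegral_congr_fun (measurableSet_slab T) hdiv] at hzero
  have hspatial := eq_zero_of_setIntegral_slab_eq_zero hT hcont (fun z => by positivity) hintg
    hzero hy
  have hsum : ∑ k : Fin 3, ‖W k.succ y‖ ^ 2 = 0 := by linarith
  exact Fin.cases (hcharge y hy) (sum_norm_sq_eq_zero_iff.1 hsum) μ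

theorem eq_zero_of_mem_slab (hJ : ∀ v w, ⟪J v, w⟫ = -⟪v, J w⟫) (hm : m ≠ 0)
    (hT : 0 < T) {R : Matrix (Fin 3) (Fin 3) ℝ} (hR : R * R.transpose = 1)
    (hA : pullback (spatialBlock R) (event T 0) A = A)
    (hW : pullback (spatialBlock R) (event T 0) W = W)
    (hfin : IntegrableOn (squareDensity J A W) (slab T)) {y : Spacetime} (hy : y ∈ slab T) :
    (∀ μ, W μ y = 0) ∧ ∀ μ ν, faraday A μ ν y = 0 := by
  have hvanish (z : Spacetime) (hz : z ∈ slab T) :=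
    h.eq_zero_of_divergence_dilationCurrent_eq_zero hJ hm
      (h.divergence_dilationCurrent_eq_zero_of_mem_slab hJ hT hR hA hW hfin hz)
  refine ⟨h.field_eq_zero_of_mem_slab hT hR hW hfin (fun z hz => (hvanish z hz).1)
    (fun z hz => ?_) hy, (hvanish y hy).2.2⟩
  obtain ⟨hcharge, hcurl, hfaraday⟩ := hvanish z hz
  exact h.divergence_radialCurrent_massStress_of_eq_zero hJ hm hcharge hcurl hfaraday

end IsProcaMaxwell

theorem forall_of_forall_mem_slab (hT : 0 < T) {R : Matrix (Fin 3) (Fin 3) ℝ}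
    (hR : R * R.transpose = 1) {P : Spacetime → Prop}
    (hshift : ∀ y, P ((spatialBlock R).mulVec y + event T 0) ↔ P y)
    (hslab : ∀ y ∈ slab T, P y) (y : Spacetime) : P y := by
  have hperiodic : Function.Periodic (fun t => ∀ x, P (event t x)) T := fun t => by
    have hsurj : Function.Surjective R.mulVec := fun x =>
      ⟨R.transpose.mulVec x, by rw [Matrix.mulVec_mulVec, hR, Matrix.one_mulVec]⟩
    refine propext (hsurj.forall.trans (forall_congr' fun x => ?_))
    rw [← hshift (event t x), spatialBlock_mulVec_event, event_add_event, add_zero]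
  obtain ⟨s, hs, hP⟩ := hperiodic.exists_mem_Ico₀ hT (y 0)
  have hall : ∀ x, P (event (y 0) x) :=
    hP.mpr fun x => hslab _ ⟨hs.1, hs.2.le⟩
  exact event_spatial y ▸ hall (spatial y)

theorem IsProcaMaxwell.eq_zero (h : IsProcaMaxwell J m A W)
    (hJ : ∀ v w, ⟪J v, w⟫ = -⟪v, J w⟫) (hm : m ≠ 0) (hT : 0 < T)
    {R : Matrix (Fin 3) (Fin 3) ℝ} (hR : R * R.transpose = 1)
    (hA : pullback (spatialBlock R) (event T 0) A = A)
    (hW : pullback (spatialBlock R) (event T 0) W = W)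
    (hfin : IntegrableOn (squareDensity J A W) (slab T)) (y : Spacetime) :
    (∀ μ, W μ y = 0) ∧ ∀ μ ν, faraday A μ ν y = 0 := by
  have hM := isLorentz_spatialBlock hR
  refine forall_of_forall_mem_slab hT hR (fun z => ?_)
    (fun z => h.eq_zero_of_mem_slab hJ hm hT hR hA hW hfin) y
  have := hM.pullback_eq_zero_iff (c := event T 0) (A := A) (W := W) h.contDiff_potential z
  rw [hA, hW] at this
  exact this.symm

end Vanishing

section Boost

variable {v : Fin 3 → ℝ}

theorem lorentzFactor_pos (hv : v ⬝ᵥ v < 1) : 0 < lorentzFactor v :=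
  one_div_pos.2 (Real.sqrt_pos.2 (by linarith))

theorem lorentzFactor_sq_mul (hv : v ⬝ᵥ v < 1) : lorentzFactor v ^ 2 * (1 - v ⬝ᵥ v) = 1 := by
  have hpos : 0 < 1 - v ⬝ᵥ v := by linarith
  rw [lorentzFactor, div_pow, Real.sq_sqrt hpos.le, one_pow, one_div_mul_cancel hpos.ne']

theorem smul_dotProduct_smul_lt_one {T : ℝ} (hT : 0 < T) {l : Fin 3 → ℝ}
    (hl : √(l ⬝ᵥ l) / T < 1) : (T⁻¹ • l) ⬝ᵥ (T⁻¹ • l) < 1 := by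
  rw [div_lt_one hT, Real.sqrt_lt' hT] at hl
  rwa [smul_dotProduct, dotProduct_smul, smul_eq_mul, smul_eq_mul, ← mul_assoc, ← mul_inv, ← sq,
    inv_mul_lt_iff₀ (pow_pos hT 2), mul_one]

theorem mulVec_event_apply (M : Matrix (Fin 4) (Fin 4) ℝ) (t : ℝ) (x : Fin 3 → ℝ) (μ : Fin 4) :
    M.mulVec (event t x) μ = M μ 0 * t + (fun k : Fin 3 => M μ k.succ) ⬝ᵥ x :=
  Fin.sum_univ_succ _

theorem boost_succ_succ (v : Fin 3 → ℝ) (i : Fin 3) :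
    (fun k : Fin 3 => boost v i.succ k.succ)
      = Pi.single i 1 + (lorentzFactor v ^ 2 / (1 + lorentzFactor v) * v i) • v := by
  funext k
  simp [boost, Pi.single_apply, eq_comm]

theorem boost_mulVec_event (v : Fin 3 → ℝ) (t : ℝ) (x : Fin 3 → ℝ) :
    (boost v).mulVec (event t x) = event (lorentzFactor v * (t + v ⬝ᵥ x))
      (x + (lorentzFactor v ^ 2 / (1 + lorentzFactor v) * v ⬝ᵥ x + lorentzFactor v * t) • v) := by
  funext μ
  rw [mulVec_event_apply]
  refine Fin.cases ?_ (fun i => ?_) μ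
  · change lorentzFactor v * t + (lorentzFactor v • v) ⬝ᵥ x = lorentzFactor v * (t + v ⬝ᵥ x)
    rw [smul_dotProduct, smul_eq_mul]
    ring
  · rw [boost_succ_succ, add_dotProduct, smul_dotProduct, single_one_dotProduct]
    simp only [boost, event, Matrix.of_apply, Matrix.cons_val_succ, Matrix.cons_val_zero,
      Pi.add_apply, Pi.smul_apply, smul_eq_mul]
    ring

theorem isLorentz_boost (hv : v ⬝ᵥ v < 1) : IsLorentz (boost v) := by
  have hfactor := lorentzFactor_sq_mul hv
  have hpos : 0 < 1 + lorentzFactor v := by linarith [lorentzFactor_pos hv]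
  have hrow_zero : (fun k : Fin 3 => boost v 0 k.succ) = lorentzFactor v • v := rfl
  have hrow_succ := boost_succ_succ v
  have hzero : boost v 0 0 = lorentzFactor v := rfl
  have hsucc (i : Fin 3) : boost v i.succ 0 = lorentzFactor v * v i := rfl
  set γ := lorentzFactor v
  set κ := γ ^ 2 / (1 + γ)
  have hκγ : κ * (1 + γ) = γ ^ 2 := div_mul_cancel₀ _ hpos.ne'
  have hκv : κ * v ⬝ᵥ v = γ - 1 :=
    mul_left_cancel₀ hpos.ne' (by linear_combination v ⬝ᵥ v * hκγ - hfactor)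
  refine isLorentz_iff.2 fun μ ν => ?_
  refine Fin.cases (Fin.cases ?_ (fun j => ?_) ν) (fun i => Fin.cases ?_ (fun j => ?_) ν) μ <;>
    simp only [hzero, hsucc, hrow_zero, hrow_succ, metric_zero_zero, metric_zero_succ,
      metric_succ_zero, metric_succ_succ, add_dotProduct, dotProduct_add, smul_dotProduct,
      dotProduct_smul, dotProduct_single_one, single_one_dotProduct, smul_eq_mul, Pi.add_apply,
      Pi.smul_apply, Pi.single_apply]
  · linear_combination hfactor
  · linear_combination (-γ * v j) * hκv
  · linear_combination (-γ * v i) * hκv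
  · rw [if_congr (eq_comm (a := j)) rfl rfl]
    linear_combination (-κ * v i * v j) * hκv - v i * v j * hκγ

theorem spatialBlock_mul_boost {R : Matrix (Fin 3) (Fin 3) ℝ} (hR : R * R.transpose = 1)
    (hv : R.mulVec v = v) : spatialBlock R * boost v = boost v * spatialBlock R := by
  have hdot (x : Fin 3 → ℝ) : v ⬝ᵥ R.mulVec x = v ⬝ᵥ x := by
    conv_lhs => rw [← hv]
    rw [Matrix.dotProduct_mulVec, Matrix.vecMul_mulVec, mul_eq_one_comm.1 hR, Matrix.vecMul_one]
  refine Matrix.ext_of_mulVec_single fun μ => ?_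
  rw [← event_spatial (Pi.single μ 1)]
  simp only [← Matrix.mulVec_mulVec, boost_mulVec_event, spatialBlock_mulVec_event,
    Matrix.mulVec_add, Matrix.mulVec_smul, hv, hdot]

end Boost

section MovingPeriod

variable {V : Type*} [NormedAddCommGroup V] [InnerProductSpace ℝ V] {J : V →L[ℝ] V} {m T : ℝ}
  {A : Fin 4 → Spacetime → ℝ} {W : Fin 4 → Spacetime → V} {R : Matrix (Fin 3) (Fin 3) ℝ}
  {v : Fin 3 → ℝ}

theorem boost_mulVec_event_zero (hv : v ⬝ᵥ v < 1) (T : ℝ) :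
    (boost v).mulVec (event (T / lorentzFactor v) 0) = event T (T • v) := by
  rw [boost_mulVec_event, dotProduct_zero, add_zero, mul_zero, zero_add, zero_add,
    mul_div_cancel₀ _ (lorentzFactor_pos hv).ne']

theorem pullback_boost_periodic (hv : v ⬝ᵥ v < 1) (hR : R * R.transpose = 1)
    (hRv : R.mulVec v = v) (hW : pullback (spatialBlock R) (event T (T • v)) W = W) :
    pullback (spatialBlock R) (event (T / lorentzFactor v) 0) (pullback (boost v) 0 W)
      = pullback (boost v) 0 W := by
  conv_rhs => rw [← hW]
  simp only [pullback_pullback, add_zero, Matrix.mulVec_zero, zero_add,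
    boost_mulVec_event_zero hv, spatialBlock_mul_boost hR hRv]

theorem IsProcaMaxwell.eq_zero_of_moving_period (h : IsProcaMaxwell J m A W)
    (hJ : ∀ v w, ⟪J v, w⟫ = -⟪v, J w⟫) (hm : m ≠ 0) (hT : 0 < T) (hv : v ⬝ᵥ v < 1)
    (hR : R * R.transpose = 1) (hRv : R.mulVec v = v)
    (hA : pullback (spatialBlock R) (event T (T • v)) A = A)
    (hW : pullback (spatialBlock R) (event T (T • v)) W = W)
    (hfin : IntegrableOn (squareDensity J (pullback (boost v) 0 A) (pullback (boost v) 0 W))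
      (slab (T / lorentzFactor v))) (x : Spacetime) :
    (∀ μ, W μ x = 0) ∧ ∀ μ ν, faraday A μ ν x = 0 := by
  have hM := isLorentz_boost hv
  obtain ⟨y, rfl⟩ := hM.exists_mulVec_eq 0 x
  exact (hM.pullback_eq_zero_iff h.contDiff_potential y).1 <|
    (hM.isProcaMaxwell_pullback h).eq_zero hJ hm (div_pos hT (lorentzFactor_pos hv)) hR
      (pullback_boost_periodic hv hR hRv hA) (pullback_boost_periodic hv hR hRv hW) hfin y

end MovingPeriod

section Fields

variable {e m T : ℝ} {Ψ : Spacetime → FieldValue} {M : Matrix (Fin 4) (Fin 4) ℝ}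
  {Ω : Matrix.specialOrthogonalGroup (Fin 3) ℝ} {l : Fin 3 → ℝ}

theorem rotation_mul_transpose (Ω : Matrix.specialOrthogonalGroup (Fin 3) ℝ) :
    Ω.1 * Ω.1.transpose = 1 :=
  (Matrix.mem_orthogonalGroup_iff (Fin 3) ℝ).1 (Matrix.mem_specialOrthogonalGroup_iff.1 Ω.2).1

theorem pull_spatialBlock_rotate {K : Type*} [Ring K] [Algebra ℝ K]
    (Ω : Matrix.specialOrthogonalGroup (Fin 3) ℝ) (a : Fin 4 → K) :
    pull (spatialBlock Ω.1) (rotate Ω a) = a := by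
  have horth (i k : Fin 3) : ∑ j, Ω.1 j i * Ω.1 j k = if i = k then 1 else 0 := by
    have hΩ : Ω.1.transpose * Ω.1 = 1 := mul_eq_one_comm.1 (rotation_mul_transpose Ω)
    have hentry := congrFun₂ hΩ i k
    rwa [Matrix.mul_apply, Matrix.one_apply] at hentry
  funext μ
  refine Fin.cases (pull_spatialBlock_zero _ _) (fun i => ?_) μ
  rw [pull_spatialBlock_succ]
  simp only [rotate, Matrix.cons_val_succ, Finset.smul_sum, smul_smul]
  rw [Finset.sum_comm]
  simp only [← Finset.sum_smul, horth, ite_smul, one_smul, zero_smul, Finset.sum_ite_eq,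
    Finset.mem_univ, if_true]

theorem PeriodicUpTo.apply_spatialBlock_mulVec_add (hper : PeriodicUpTo T Ω l Ψ)
    (hl : Ω.1.mulVec l = l) (y : Spacetime) :
    (Ψ ((spatialBlock Ω.1).mulVec y + event T l)).1 = rotate Ω (Ψ y).1 ∧
    (Ψ ((spatialBlock Ω.1).mulVec y + event T l)).2 = rotate Ω (Ψ y).2 := by
  have hinv : (Ω⁻¹).1 * Ω.1 = 1 := congrArg Subtype.val (inv_mul_cancel Ω)
  have hspatial : (Ω⁻¹).1.mulVec (Ω.1.mulVec (spatial y) + l) - l = spatial y := by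
    conv_lhs => enter [1, 2, 2]; rw [← hl]
    rw [← Matrix.mulVec_add, Matrix.mulVec_mulVec, hinv, Matrix.one_mulVec, add_sub_cancel_right]
  have hy := hper (y 0) (Ω.1.mulVec (spatial y) + l)
  rwa [hspatial, event_spatial, ← event_add_event, ← spatialBlock_mulVec_event,
    event_spatial] at hy

theorem PeriodicUpTo.pullback_vectorPart (hper : PeriodicUpTo T Ω l Ψ)
    (hl : Ω.1.mulVec l = l) :
    pullback (spatialBlock Ω.1) (event T l) (vectorPart Ψ) = vectorPart Ψ := by
  funext μ y
  refine Eq.trans ?_ (congrFun (pull_spatialBlock_rotate Ω (Ψ y).1) μ)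
  exact congrArg (pull _ · μ) (hper.apply_spatialBlock_mulVec_add hl y).1

theorem PeriodicUpTo.pullback_potentialPart (hper : PeriodicUpTo T Ω l Ψ)
    (hl : Ω.1.mulVec l = l) :
    pullback (spatialBlock Ω.1) (event T l) (potentialPart Ψ) = potentialPart Ψ := by
  funext μ y
  refine Eq.trans ?_ (congrFun (pull_spatialBlock_rotate Ω (Ψ y).2) μ)
  exact congrArg (pull _ · μ) (hper.apply_spatialBlock_mulVec_add hl y).2

theorem vectorPart_changeFrame (M : Matrix (Fin 4) (Fin 4) ℝ) (Ψ : Spacetime → FieldValue) :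
    vectorPart (changeFrame M Ψ) = pullback M 0 (vectorPart Ψ) := by
  funext μ y
  simp only [vectorPart, changeFrame, pullback, pull, add_zero]

theorem potentialPart_changeFrame (M : Matrix (Fin 4) (Fin 4) ℝ) (Ψ : Spacetime → FieldValue) :
    potentialPart (changeFrame M Ψ) = pullback M 0 (potentialPart Ψ) := by
  funext μ y
  simp only [potentialPart, changeFrame, pullback, pull, add_zero, smul_eq_mul]

theorem contDiff_changeFrame (hΨ : ContDiff ℝ ∞ Ψ) : ContDiff ℝ ∞ (changeFrame M Ψ) := by
  have hvector := contDiff_pullback (M := M) (c := 0) (contDiff_vectorPart hΨ)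
  have hpotential := contDiff_pullback (M := M) (c := 0) (contDiff_potentialPart hΨ)
  rw [← vectorPart_changeFrame] at hvector
  rw [← potentialPart_changeFrame] at hpotential
  exact (contDiff_pi.2 hvector).prodMk (contDiff_pi.2 hpotential)

theorem squareDensity_eq_sum_density (hm : m ≠ 0) (hΨ : ContDiff ℝ ∞ Ψ) (y : Spacetime) :
    squareDensity (generator e) (potentialPart Ψ) (vectorPart Ψ) y
      = ∑ k, ![2, 2, (m ^ 2)⁻¹, (m ^ 2)⁻¹, 4, 4] k * density e m (Ψ y) (grad Ψ y) k := by
  simp only [squareDensity_eq, ← strengthW_grad hΨ, ← strengthF_grad hΨ, density, vectorPart,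
    Real.norm_eq_abs, sq_abs, Fin.sum_univ_six, Matrix.cons_val, ← Finset.mul_sum,
    inv_mul_cancel_left₀ (pow_ne_zero 2 hm)]
  ring

theorem FiniteIntegrals.integrableOn_squareDensity (hfin : FiniteIntegrals e m T Ψ) (hm : m ≠ 0)
    (hΨ : ContDiff ℝ ∞ Ψ) :
    IntegrableOn (squareDensity (generator e) (potentialPart Ψ) (vectorPart Ψ)) (slab T) := by
  refine IntegrableOn.congr_fun ?_
    (fun y _ => (squareDensity_eq_sum_density hm hΨ y).symm) (measurableSet_slab T)
  exact integrable_finsetSum _ fun k _ => (hfin k).const_mul _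

end Fields

section Poincare

theorem exists_partialDeriv_eq_of_faraday_eq_zero {A : Fin 4 → Spacetime → ℝ}
    (hA : ∀ μ, ContDiff ℝ ∞ (A μ)) (hF : ∀ μ ν x, faraday A μ ν x = 0) :
    ∃ χ : Spacetime → ℝ, ContDiff ℝ ∞ χ ∧ ∀ x μ, A μ x = partialDeriv μ χ x := by
  set θ : Spacetime → Spacetime →L[ℝ] ℝ :=
    fun y => ∑ ν, A ν y • ContinuousLinearMap.proj (R := ℝ) (φ := fun _ : Fin 4 => ℝ) ν with hθ
  have hθ_smooth : ContDiff ℝ ∞ θ := ContDiff.sum fun ν _ => (hA ν).smul contDiff_const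
  have hθ_single (y : Spacetime) (μ : Fin 4) : θ y (Pi.single μ 1) = A μ y := by
    simp [hθ, Pi.single_apply]
  have hfderiv (a x y : Spacetime) :
      fderiv ℝ θ a x y = ∑ ν, ∑ μ, x ν * y μ * partialDeriv ν (A μ) a := by
    have hθ' : ∀ ν μ, partialDeriv ν θ a (Pi.single μ 1) = partialDeriv ν (A μ) a := fun ν μ => by
      refine (partialDeriv_clm_comp (ContinuousLinearMap.apply ℝ ℝ (Pi.single μ 1 : Spacetime))
        (differentiableAt_of_smooth hθ_smooth) ν).symm.trans ?_
      simp only [ContinuousLinearMap.apply_apply, hθ_single]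
    conv_lhs => rw [fderiv_apply_eq_sum_partialDeriv, pi_eq_sum_univ' y]
    simp only [map_sum, map_smul, sum_apply, smul_apply, hθ', smul_eq_mul, Finset.mul_sum]
    rw [Finset.sum_comm]
    exact Finset.sum_congr rfl fun ν _ => Finset.sum_congr rfl fun μ _ => by ring
  have hsymm (a x y : Spacetime) : fderiv ℝ θ a x y = fderiv ℝ θ a y x := by
    rw [hfderiv, hfderiv, Finset.sum_comm]
    refine Finset.sum_congr rfl fun μ _ => Finset.sum_congr rfl fun ν _ => ?_
    rw [sub_eq_zero.1 (hF μ ν a), mul_comm (x ν)]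
  obtain ⟨χ, hχ⟩ := convex_univ.exists_forall_hasFDerivAt_of_fderiv_symmetric isOpen_univ
    (hθ_smooth.differentiable (by simp)).differentiableOn fun a _ => hsymm a
  have hχ_deriv : fderiv ℝ χ = θ := funext fun y => (hχ y (Set.mem_univ y)).fderiv
  refine ⟨χ, contDiff_infty_iff_fderiv.2
    ⟨fun y => (hχ y (Set.mem_univ y)).differentiableAt, hχ_deriv ▸ hθ_smooth⟩, fun x μ => ?_⟩
  rw [partialDeriv, hχ_deriv, hθ_single]

end Poincare

end

end ChargedVector

theorem proposition1_general (e m : ℝ) (hm : m ≠ 0)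
    (Ψ : ChargedVector.Spacetime → ChargedVector.FieldValue)
    (hsmooth : ContDiff ℝ ((⊤ : ℕ∞) : WithTop ℕ∞) Ψ)
    (hsol : ChargedVector.EulerLagrange (ChargedVector.lagrangian e m) Ψ)
    (T : ℝ) (hT : 0 < T)
    (Ω : Matrix.specialOrthogonalGroup (Fin 3) ℝ) (l : Fin 3 → ℝ)
    (hΩl : Ω.1.mulVec l = l) (hsub : √(l ⬝ᵥ l) / T < 1)
    (hper : ChargedVector.PeriodicUpTo T Ω l Ψ)
    (hfin : ChargedVector.FiniteIntegrals e m (T / ChargedVector.lorentzFactor (T⁻¹ • l))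
      (ChargedVector.changeFrame (ChargedVector.boost (T⁻¹ • l)) Ψ)) :
    (∀ x, (Ψ x).1 = 0) ∧
    (∀ x μ ν, ChargedVector.strengthF (ChargedVector.grad Ψ x) μ ν = 0) ∧
    (∃ χ : ChargedVector.Spacetime → ℝ, ContDiff ℝ ((⊤ : ℕ∞) : WithTop ℕ∞) χ ∧
      ∀ x μ, (Ψ x).2 μ = ChargedVector.partialDeriv μ χ x) := by
  have hvel : (T⁻¹ • l) ⬝ᵥ (T⁻¹ • l) < 1 := ChargedVector.smul_dotProduct_smul_lt_one hT hsub
  have hshift : T • T⁻¹ • l = l := smul_inv_smul₀ hT.ne' l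
  have hintg := hfin.integrableOn_squareDensity hm (ChargedVector.contDiff_changeFrame hsmooth)
  rw [ChargedVector.vectorPart_changeFrame, ChargedVector.potentialPart_changeFrame] at hintg
  have hzero := (hsol.isProcaMaxwell hsmooth).eq_zero_of_moving_period
    ChargedVector.inner_generator_left hm hT hvel (ChargedVector.rotation_mul_transpose Ω)
    (by rw [Matrix.mulVec_smul, hΩl]) (by rw [hshift, hper.pullback_potentialPart hΩl])
    (by rw [hshift, hper.pullback_vectorPart hΩl]) hintg
  exact ⟨fun x => funext (hzero x).1,
    fun x μ ν => (ChargedVector.strengthF_grad hsmooth x μ ν).trans ((hzero x).2 μ ν),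
    ChargedVector.exists_partialDeriv_eq_of_faraday_eq_zero
      (ChargedVector.contDiff_potentialPart hsmooth) fun μ ν x => (hzero x).2 μ ν⟩

theorem proposition1 (e m : ℝ) (hm : m ≠ 0)
    (Ψ : ChargedVector.Spacetime → ChargedVector.FieldValue)
    (hsmooth : ContDiff ℝ ((⊤ : ℕ∞) : WithTop ℕ∞) Ψ)
    (hsol : ChargedVector.EulerLagrange (ChargedVector.lagrangian e m) Ψ)
    (hvanish : ChargedVector.VanishesAtSpatialInfinity Ψ)
    (T : ℝ) (hT : 0 < T)
    (Ω : Matrix.specialOrthogonalGroup (Fin 3) ℝ) (l : Fin 3 → ℝ)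
    (hΩl : Ω.1.mulVec l = l) (hsub : √(l ⬝ᵥ l) / T < 1)
    (hper : ChargedVector.PeriodicUpTo T Ω l Ψ)
    -- the integrals are taken over one period in the frame moving with velocity `l / T`
    (hfin : ChargedVector.FiniteIntegrals e m (T / ChargedVector.lorentzFactor (T⁻¹ • l))
      (ChargedVector.changeFrame (ChargedVector.boost (T⁻¹ • l)) Ψ)) :
    -- the complex vector field vanishes identically
    (∀ x, (Ψ x).1 = 0) ∧
    -- the electromagnetic field vanishes identically
    (∀ x μ ν, ChargedVector.strengthF (ChargedVector.grad Ψ x) μ ν = 0) ∧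
    -- the electromagnetic potential is a pure gauge
    (∃ χ : ChargedVector.Spacetime → ℝ, ContDiff ℝ ((⊤ : ℕ∞) : WithTop ℕ∞) χ ∧
      ∀ x μ, (Ψ x).2 μ = ChargedVector.partialDeriv μ χ x) :=
  proposition1_general e m hm Ψ hsmooth hsol T hT Ω l hΩl hsub hper hfin
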